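/- Let $\mathbf k$ be a field and let $H$ be a finite-dimensional Hopf algebra over $\mathbf k$ with counit $\varepsilon$ and coproduct written $h\mapsto\sum h_{(1)}\otimes h_{(2)}$. Let $r$ be a universal $r$-form on $H$, i.e. a convolution invertible element of $(H\otimes H)^*$ such that for all $a,b,c\in H$ $$r(ab\otimes c)=\sum r(a\otimes c_{(1)})\,r(b\otimes c_{(2)}),\qquad r(a\otimes bc)=\sum r(a_{(1)}\otimes c)\,r(a_{(2)}\otimes b),$$ $$\sum r(a_{(1)}\otimes b_{(1)})\,a_{(2)}b_{(2)}=\sum b_{(1)}a_{(1)}\,r(a_{(2)}\otimes b_{(2)}).$$ Let $\sigma$ be a left $2$-cocycle for $H$, i.e. a convolution invertible element of $(H\otimes H)^*$ with $\sigma(h\otimes 1)=\sigma(1\otimes h)=\varepsilon(h)$ and $$\sum\sigma(k_{(1)}\otimes m_{(1)})\,\sigma(h\otimes k_{(2)}m_{(2)})=\sum\sigma(h_{(1)}\otimes k_{(1)})\,\sigma(h_{(2)}k_{(2)}\otimes m)\qquad(h,k,m\in H).$$ A right $H^{op}$-comodule algebra is an algebra $A$ that is a right $H$-comodule, with coaction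 $a\mapsto\sum a_{(0)}\otimes a_{(1)}$, such that $1\mapsto 1\otimes 1$ and $ab\mapsto\sum a_{(0)}b_{(0)}\otimes b_{(1)}a_{(1)}$. Its opposite $\overline A$ is the comodule $A$ with product $a\circ b=\sum b_{(0)}a_{(0)}\,r(b_{(1)}\otimes a_{(1)})$. For two such algebras $A,B$, the algebra $A\#B$ is the space $A\otimes B$ with product $(a\#b)(c\#d)=\sum ac_{(0)}\#b_{(0)}d\;r(c_{(1)}\otimes b_{(1)})$. A finite-dimensional right $H^{op}$-comodule algebra $A$ is called $(H,r)$-Azumaya if the algebra maps $$F\colon A\#\overline A\to \mathrm{End}(A),\quad F(a\#b)(c)=\sum a\,c_{(0)}b_{(0)}\,r(c_{(1)}\otimes b_{(1)}),$$ $$G\colon \overline A\#A\to \mathrm{End}(A)^{op},\quad G(a\#b)(c)=\sum r(a_{(1)}\otimes c_{(1)})\,a_{(0)}c_{(0)}\,b$$ are both isomorphisms. Let $A_\sigma={}_{\sigma\tau}H^{op}$ (with $\tau$ the flip) be the right $H^{op}$-comodule algebra that equals $H$ as a vector space, with the coproduct of $H$ as coaction and with product $h\cdot k=\sum\sigma(k_{(1)}\otimes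 h_{(1)})\,k_{(2)}h_{(2)}$. Let $r_\sigma=(\sigma\tau)*r*\sigma^{-1}$ (convolution product in $(H\otimes H)^*$), and let $$\theta_\sigma\colon H\to H^*,\qquad \theta_\sigma(h)=r_\sigma(-\otimes h)$$ (a map from $({}_\sigma H_{\sigma^{-1}})^{op}$ to $({}_\sigma H_{\sigma^{-1}})^*$, where the twisted Hopf algebra ${}_\sigma H_{\sigma^{-1}}$ has the same underlying vector space as $H$). Then $A_\sigma$ is $(H,r)$-Azumaya if and only if $\theta_\sigma$ is bijective. -/

import Mathlib

noncomputable section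

set_option linter.unusedSectionVars false

namespace CleftAzumaya

open scoped TensorProduct
open Coalgebra LinearMap WithConv

variable (k : Type*) [Field k] (H : Type*) [Ring H] [HopfAlgebra k H]

/-- Bilinear forms on `H`, seen as functionals on the coalgebra `H ⊗ H`, with the convolution
product `(f * g)(h ⊗ l) = ∑ f(h₁ ⊗ l₁) g(h₂ ⊗ l₂)`. -/
abbrev ConvForm : Type _ := WithConv (H ⊗[k] H →ₗ[k] k)

variable {k H}

/-- `x ↦ ∑ f(x₁) g(x₂)`, for a functional `f` and a linear map `g` on a coalgebra `C`. -/
def convSMul {C N : Type*} [AddCommGroup C] [Module k C] [Coalgebra k C]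
    [AddCommGroup N] [Module k N] (f : C →ₗ[k] k) (g : C →ₗ[k] N) : C →ₗ[k] N :=
  (TensorProduct.lid k N).toLinearMap ∘ₗ TensorProduct.map f g ∘ₗ comul

/-- `x ↦ ∑ g(x₁) f(x₂)`, for a functional `f` and a linear map `g` on a coalgebra `C`. -/
def smulConv {C N : Type*} [AddCommGroup C] [Module k C] [Coalgebra k C]
    [AddCommGroup N] [Module k N] (g : C →ₗ[k] N) (f : C →ₗ[k] k) : C →ₗ[k] N :=
  (TensorProduct.rid k N).toLinearMap ∘ₗ TensorProduct.map g f ∘ₗ comul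

variable (k H)

/-- A universal `r`-form on `H` (a dual quasitriangular structure): a convolution invertible
form `r` on `H ⊗ H` with
* `r(ab ⊗ c) = ∑ r(a ⊗ c₁) r(b ⊗ c₂)`,
* `r(a ⊗ bc) = ∑ r(a₁ ⊗ c) r(a₂ ⊗ b)`,
* `∑ r(a₁ ⊗ b₁) a₂ b₂ = ∑ b₁ a₁ r(a₂ ⊗ b₂)`. -/
structure UniversalRForm where
  /-- the form, together with its convolution inverse -/
  form : (ConvForm k H)ˣ
  mul_left : ∀ a b c : H, form.val.ofConv ((a * b) ⊗ₜ c) =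
    mul' k k (TensorProduct.map (TensorProduct.curry form.val.ofConv a)
      (TensorProduct.curry form.val.ofConv b) (comul c))
  mul_right : ∀ a b c : H, form.val.ofConv (a ⊗ₜ (b * c)) =
    mul' k k (TensorProduct.map ((TensorProduct.curry form.val.ofConv).flip c)
      ((TensorProduct.curry form.val.ofConv).flip b) (comul a))
  quasi_comm : convSMul form.val.ofConv (mul' k H) =
    smulConv (mul' k H ∘ₗ (TensorProduct.comm k H H).toLinearMap) form.val.ofConv

/-- A (normalized) left 2-cocycle for `H`: a convolution invertible form `σ` on `H ⊗ H` with
* `σ(h ⊗ 1) = σ(1 ⊗ h) = ε(h)`,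
* `∑ σ(l₁ ⊗ m₁) σ(h ⊗ l₂ m₂) = ∑ σ(h₁ ⊗ l₁) σ(h₂ l₂ ⊗ m)`. -/
structure LeftTwoCocycle where
  /-- the form, together with its convolution inverse -/
  form : (ConvForm k H)ˣ
  apply_one_right : ∀ h : H, form.val.ofConv (h ⊗ₜ 1) = counit h
  apply_one_left : ∀ h : H, form.val.ofConv (1 ⊗ₜ h) = counit h
  cocycle : ∀ h l m : H,
    convSMul form.val.ofConv (TensorProduct.curry form.val.ofConv h ∘ₗ mul' k H) (l ⊗ₜ m) =
    convSMul form.val.ofConv ((TensorProduct.curry form.val.ofConv).flip m ∘ₗ mul' k H) (h ⊗ₜ l)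

/-- A right `H`-comodule `M`, with coaction `m ↦ ∑ m₀ ⊗ m₁`. -/
class RightComodule (M : Type*) [AddCommGroup M] [Module k M] where
  /-- the coaction -/
  coact : M →ₗ[k] M ⊗[k] H
  coassoc : (TensorProduct.assoc k M H H).toLinearMap ∘ₗ coact.rTensor H ∘ₗ coact =
    (comul (R := k) (A := H)).lTensor M ∘ₗ coact
  counit_coact : (TensorProduct.rid k M).toLinearMap ∘ₗ
    (counit (R := k) (A := H)).lTensor M ∘ₗ coact = LinearMap.id

open RightComodule (coact)

/-- The comodule structure transported along a linear isomorphism. -/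
abbrev RightComodule.ofEquiv {M N : Type*} [AddCommGroup M] [Module k M] [AddCommGroup N]
    [Module k N] [RightComodule k H M] (e : M ≃ₗ[k] N) : RightComodule k H N where
  coact := e.toLinearMap.rTensor H ∘ₗ coact ∘ₗ e.symm.toLinearMap
  coassoc := by
    ext a
    have h := congr(e.toLinearMap.rTensor (H ⊗[k] H)
      $(LinearMap.congr_fun (RightComodule.coassoc (k := k) (H := H)) (e.symm a)))
    simp only [LinearMap.comp_apply, LinearEquiv.coe_coe] at h ⊢
    have h1 : ∀ x : M ⊗[k] H, (comul (R := k) (A := H)).lTensor N (e.toLinearMap.rTensor H x) =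
        e.toLinearMap.rTensor (H ⊗[k] H) (comul.lTensor M x) := by
      intro x
      induction x with
      | zero => simp
      | add x y hx hy => simp only [map_add, hx, hy]
      | tmul m h => simp
    rw [h1, ← h]
    generalize coact (k := k) (H := H) (e.symm a) = x
    induction x with
    | zero => simp
    | add x y hx hy => simp only [map_add, hx, hy]
    | tmul m h =>
      simp only [rTensor_tmul, LinearMap.comp_apply, LinearEquiv.coe_coe,
        LinearEquiv.symm_apply_apply]
      generalize coact (k := k) (H := H) m = x
      induction x with
      | zero => simp
      | add x y hx hy => simp only [map_add, TensorProduct.add_tmul, hx, hy]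
      | tmul m h => simp
  counit_coact := by
    ext a
    have h := congr(e $(LinearMap.congr_fun (RightComodule.counit_coact (k := k) (H := H))
      (e.symm a)))
    simp only [LinearMap.comp_apply, LinearEquiv.coe_coe, LinearMap.id_apply,
      LinearEquiv.apply_symm_apply] at h ⊢
    refine Eq.trans ?_ h
    generalize coact (k := k) (H := H) (e.symm a) = x
    induction x with
    | zero => simp
    | add x y hx hy => simp only [map_add, hx, hy]
    | tmul m h => simp

/-- A right `Hᵒᵖ`-comodule algebra, that is, an algebra in the monoidal category of right
`H`-comodules where `M ⊗ N` carries the coaction `m ⊗ n ↦ ∑ m₀ ⊗ n₀ ⊗ n₁ m₁`: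
`∑ (ab)₀ ⊗ (ab)₁ = ∑ a₀ b₀ ⊗ b₁ a₁` and `1 ↦ 1 ⊗ 1`. -/
class OpComoduleAlgebra (A : Type*) [Ring A] [Algebra k A] extends RightComodule k H A where
  coact_one : coact (1 : A) = 1 ⊗ₜ[k] (1 : H)
  coact_mul : ∀ a b : A, coact (a * b) =
    TensorProduct.map (mul' k A) (mul' k H ∘ₗ (TensorProduct.comm k H H).toLinearMap)
      (TensorProduct.tensorTensorTensorComm k A H A H (coact a ⊗ₜ coact b))

variable {k H}

/-- The braiding `ψ(m ⊗ n) = ∑ n₀ ⊗ m₀ r(n₁ ⊗ m₁)` of right `H`-comodules. -/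
def braiding (r : UniversalRForm k H) (M N : Type*) [AddCommGroup M] [Module k M]
    [RightComodule k H M] [AddCommGroup N] [Module k N] [RightComodule k H N] :
    M ⊗[k] N →ₗ[k] N ⊗[k] M :=
  (TensorProduct.rid k (N ⊗[k] M)).toLinearMap ∘ₗ
    (r.form.val.ofConv).lTensor (N ⊗[k] M) ∘ₗ
    (TensorProduct.tensorTensorTensorComm k N H M H).toLinearMap ∘ₗ
    TensorProduct.map (coact (k := k) (H := H)) (coact (k := k) (H := H)) ∘ₗ
    (TensorProduct.comm k M N).toLinearMap

section Braiding

variable (r : UniversalRForm k H) {M N : Type*} [AddCommGroup M] [Module k M]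
    [RightComodule k H M] [AddCommGroup N] [Module k N] [RightComodule k H N]

/-- `m ↦ ∑ f(m₁) m₀`. -/
def act (M : Type*) [AddCommGroup M] [Module k M] [RightComodule k H M] (f : H →ₗ[k] k) :
    M →ₗ[k] M :=
  (TensorProduct.rid k M).toLinearMap ∘ₗ f.lTensor M ∘ₗ coact

theorem act_act (f g : H →ₗ[k] k) (m : M) :
    act M f (act M g m) = act M (mul' k k ∘ₗ TensorProduct.map f g ∘ₗ comul) m := by
  have h := congr(TensorProduct.rid k M ((mul' k k ∘ₗ TensorProduct.map f g).lTensor M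
    $(LinearMap.congr_fun (RightComodule.coassoc (k := k) (H := H) (M := M)) m)))
  simp only [act, LinearMap.comp_apply, LinearEquiv.coe_coe] at h ⊢
  rw [LinearMap.lTensor_comp, LinearMap.lTensor_comp, LinearMap.comp_apply, LinearMap.comp_apply]
  rw [LinearMap.lTensor_comp, LinearMap.comp_apply, LinearMap.comp_apply] at h
  rw [← h]
  generalize coact (k := k) (H := H) m = x
  induction x with
  | zero => simp
  | add x y hx hy => simp only [map_add, hx, hy]
  | tmul m h =>
    simp only [lTensor_tmul, rTensor_tmul, TensorProduct.rid_tmul, map_smul]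
    generalize coact (k := k) (H := H) m = x
    induction x with
    | zero => simp
    | add x y hx hy => simp only [map_add, TensorProduct.add_tmul, smul_add, hx, hy]
    | tmul m l => simp [mul_smul, smul_comm (g h)]

theorem act_counit (m : M) : act M (counit (R := k) (A := H)) m = m :=
  LinearMap.congr_fun (RightComodule.counit_coact (k := k) (H := H) (M := M)) m

theorem braiding_eq_left {ι : Type*} (s : Finset ι) (n₀ : ι → N) (n₁ : ι → H) (m : M) (n : N)
    (hn : coact n = ∑ i ∈ s, n₀ i ⊗ₜ[k] n₁ i) :
    braiding r M N (m ⊗ₜ n) =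
      ∑ i ∈ s, n₀ i ⊗ₜ act M (TensorProduct.curry r.form.val.ofConv (n₁ i)) m := by
  simp only [braiding, LinearMap.comp_apply, LinearEquiv.coe_coe, TensorProduct.comm_tmul,
    TensorProduct.map_tmul, hn, TensorProduct.sum_tmul, map_sum, act]
  refine Finset.sum_congr rfl fun i _ => ?_
  generalize coact (k := k) (H := H) m = x
  induction x with
  | zero => simp
  | add x y hx hy => simp only [map_add, TensorProduct.tmul_add, hx, hy]
  | tmul m l => simp

theorem braiding_eq_right {ι : Type*} (s : Finset ι) (m₀ : ι → M) (m₁ : ι → H) (m : M) (n : N)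
    (hm : coact m = ∑ i ∈ s, m₀ i ⊗ₜ[k] m₁ i) :
    braiding r M N (m ⊗ₜ n) =
      ∑ i ∈ s, act N ((TensorProduct.curry r.form.val.ofConv).flip (m₁ i)) n ⊗ₜ m₀ i := by
  simp only [braiding, LinearMap.comp_apply, LinearEquiv.coe_coe, TensorProduct.comm_tmul,
    TensorProduct.map_tmul, hm, TensorProduct.tmul_sum, map_sum, act]
  refine Finset.sum_congr rfl fun i _ => ?_
  generalize coact (k := k) (H := H) n = x
  induction x with
  | zero => simp
  | add x y hx hy => simp only [map_add, TensorProduct.add_tmul, hx, hy]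
  | tmul m l => simp [TensorProduct.smul_tmul']

theorem exists_coact (m : M) : ∃ S : Finset (M × H), coact m = ∑ p ∈ S, p.1 ⊗ₜ[k] p.2 :=
  TensorProduct.exists_finset _

theorem eq_counit_of_idem (f g : H →ₗ[k] k)
    (h1 : toConv f * toConv f = toConv f) (h2 : toConv f * toConv g = 1) : f = counit := by
  have : toConv f = 1 := by
    calc toConv f = toConv f * (toConv f * toConv g) := by rw [h2, mul_one]
      _ = 1 := by rw [← mul_assoc, h1, h2]
  ext x
  simpa using congr(($this).ofConv x)

theorem UniversalRForm.one_left : TensorProduct.curry r.form.val.ofConv 1 = counit := by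
  refine eq_counit_of_idem _ (TensorProduct.curry (r.form⁻¹).val.ofConv 1) ?_ ?_
  · ext c
    simpa using (r.mul_left 1 1 c).symm
  · ext c
    have h := congr(($(r.form.mul_inv)).ofConv (1 ⊗ₜ c))
    simp only [LinearMap.convMul_def, LinearMap.comp_apply, TensorProduct.comul_tmul,
      Bialgebra.comul_one, Algebra.TensorProduct.one_def] at h ⊢
    rw [← (ℛ k c).eq] at h ⊢
    simpa [TensorProduct.tmul_sum, LinearMap.convOne_def] using h

theorem UniversalRForm.one_right :
    (TensorProduct.curry r.form.val.ofConv).flip 1 = counit := by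
  refine eq_counit_of_idem _ ((TensorProduct.curry (r.form⁻¹).val.ofConv).flip 1) ?_ ?_
  · ext c
    simpa using (r.mul_right c 1 1).symm
  · ext c
    have h := congr(($(r.form.mul_inv)).ofConv (c ⊗ₜ 1))
    simp only [LinearMap.convMul_def, LinearMap.comp_apply, TensorProduct.comul_tmul,
      Bialgebra.comul_one, Algebra.TensorProduct.one_def] at h ⊢
    rw [← (ℛ k c).eq] at h ⊢
    simpa [TensorProduct.sum_tmul, LinearMap.convOne_def] using h

section Algebras

variable {A B : Type*} [Ring A] [Algebra k A] [OpComoduleAlgebra k H A]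
  [Ring B] [Algebra k B] [OpComoduleAlgebra k H B]

theorem braiding_one_right (m : M) : braiding r M A (m ⊗ₜ 1) = 1 ⊗ₜ m := by
  rw [braiding_eq_left r (Finset.univ : Finset Unit) (fun _ => 1) (fun _ => 1) m 1
    (by simpa using OpComoduleAlgebra.coact_one)]
  simp [r.one_left, act_counit]

theorem braiding_one_left (n : N) : braiding r A N (1 ⊗ₜ n) = n ⊗ₜ 1 := by
  rw [braiding_eq_right r (Finset.univ : Finset Unit) (fun _ => 1) (fun _ => 1) 1 n
    (by simpa using OpComoduleAlgebra.coact_one)]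
  simp [r.one_right, act_counit]

theorem braiding_comp_right (p : N ⊗[k] N →ₗ[k] N)
    (hp : ∀ c d : N, coact (p (c ⊗ₜ d)) =
      TensorProduct.map p (mul' k H ∘ₗ (TensorProduct.comm k H H).toLinearMap)
        (TensorProduct.tensorTensorTensorComm k N H N H (coact c ⊗ₜ coact d)))
    (m : M) (c d : N) : braiding r M N (m ⊗ₜ p (c ⊗ₜ d)) =
    p.rTensor M ((TensorProduct.assoc k N N M).symm
      ((braiding r M N ∘ₗ (TensorProduct.mk k M N).flip d).lTensor N
        (braiding r M N (m ⊗ₜ c)))) := by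
  obtain ⟨S, hS⟩ := exists_coact (k := k) (H := H) c
  obtain ⟨T, hT⟩ := exists_coact (k := k) (H := H) d
  have h : coact (p (c ⊗ₜ d)) = ∑ q ∈ S ×ˢ T, p (q.1.1 ⊗ₜ q.2.1) ⊗ₜ[k] (q.2.2 * q.1.2) := by
    rw [hp, hS, hT, Finset.sum_product]
    simp [TensorProduct.sum_tmul, TensorProduct.tmul_sum]
    rw [Finset.sum_comm]
  have hr : ∀ x y : H, TensorProduct.curry r.form.val.ofConv (x * y) =
      mul' k k ∘ₗ TensorProduct.map (TensorProduct.curry r.form.val.ofConv x)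
      (TensorProduct.curry r.form.val.ofConv y) ∘ₗ comul := by
    intro x y
    ext z
    exact r.mul_left x y z
  rw [braiding_eq_left r _ _ _ m _ h, braiding_eq_left r _ _ _ m _ hS, Finset.sum_product]
  simp only [map_sum, lTensor_tmul, LinearMap.comp_apply, LinearMap.flip_apply,
    TensorProduct.mk_apply, hr, ← act_act]
  refine Finset.sum_congr rfl fun i _ => ?_
  rw [braiding_eq_left r _ _ _ _ _ hT]
  simp [TensorProduct.tmul_sum]

theorem braiding_mul_right (m : M) (c d : A) : braiding r M A (m ⊗ₜ (c * d)) =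
    (mul' k A).rTensor M ((TensorProduct.assoc k A A M).symm
      ((braiding r M A ∘ₗ (TensorProduct.mk k M A).flip d).lTensor A
        (braiding r M A (m ⊗ₜ c)))) :=
  braiding_comp_right r (mul' k A) (fun c d => OpComoduleAlgebra.coact_mul c d) m c d

theorem braiding_mul_left (a b : A) (n : N) : braiding r A N ((a * b) ⊗ₜ n) =
    (mul' k A).lTensor N (TensorProduct.assoc k N A A
      ((braiding r A N ∘ₗ TensorProduct.mk k A N a).rTensor A
        (braiding r A N (b ⊗ₜ n)))) := by
  obtain ⟨S, hS⟩ := exists_coact (k := k) (H := H) a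
  obtain ⟨T, hT⟩ := exists_coact (k := k) (H := H) b
  have h : coact (a * b) = ∑ p ∈ T ×ˢ S, (p.2.1 * p.1.1) ⊗ₜ[k] (p.1.2 * p.2.2) := by
    rw [OpComoduleAlgebra.coact_mul, hS, hT, Finset.sum_product]
    simp [TensorProduct.sum_tmul, TensorProduct.tmul_sum]
  have hr : ∀ x y : H, (TensorProduct.curry r.form.val.ofConv).flip (x * y) =
      mul' k k ∘ₗ TensorProduct.map ((TensorProduct.curry r.form.val.ofConv).flip y)
      ((TensorProduct.curry r.form.val.ofConv).flip x) ∘ₗ comul := by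
    intro x y
    ext z
    exact r.mul_right z x y
  rw [braiding_eq_right r _ _ _ _ n h, braiding_eq_right r _ _ _ _ n hT, Finset.sum_product]
  simp only [map_sum, rTensor_tmul, LinearMap.comp_apply,
    TensorProduct.mk_apply, hr, ← act_act]
  refine Finset.sum_congr rfl fun i _ => ?_
  rw [braiding_eq_right r _ _ _ _ _ hS]
  simp [TensorProduct.sum_tmul]

end Algebras

end Braiding

section MulTensor

variable (A : Type*) [Ring A] [Algebra k A]

/-- `(b ⊗ s ⊗ t) ⊗ (a ⊗ p ⊗ q) ↦ b a ⊗ K(s ⊗ t ⊗ p ⊗ q)`. -/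
def mulTensor (K : (H ⊗[k] H) ⊗[k] (H ⊗[k] H) →ₗ[k] H) :
    (A ⊗[k] (H ⊗[k] H)) ⊗[k] (A ⊗[k] (H ⊗[k] H)) →ₗ[k] A ⊗[k] H :=
  TensorProduct.map (mul' k A) K ∘ₗ
    (TensorProduct.tensorTensorTensorComm k A (H ⊗[k] H) A (H ⊗[k] H)).toLinearMap

variable {A}

theorem mulTensor_comul (K : (H ⊗[k] H) ⊗[k] (H ⊗[k] H) →ₗ[k] H) (x y : A ⊗[k] H) :
    mulTensor A K ((comul (R := k)).lTensor A x ⊗ₜ (comul (R := k)).lTensor A y) =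
      TensorProduct.map (mul' k A) (K ∘ₗ TensorProduct.map comul comul)
        (TensorProduct.tensorTensorTensorComm k A H A H (x ⊗ₜ y)) := by
  induction x with
  | zero => simp
  | add x x' hx hx' => simp only [map_add, TensorProduct.add_tmul, hx, hx']
  | tmul b h =>
    induction y with
    | zero => simp
    | add x x' hx hx' => simp only [map_add, TensorProduct.tmul_add, hx, hx']
    | tmul a l => simp [mulTensor]

end MulTensor

section Opposite

variable (r : UniversalRForm k H) {A : Type*} [Ring A] [Algebra k A] [OpComoduleAlgebra k H A]

theorem coact_opMul_aux1 (x y : A ⊗[k] H) :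
    coact (H := H) (mul' k A (TensorProduct.rid k (A ⊗[k] A) (r.form.val.ofConv.lTensor (A ⊗[k] A)
      (TensorProduct.tensorTensorTensorComm k A H A H (x ⊗ₜ y))))) =
    mulTensor A ((TensorProduct.rid k H).toLinearMap ∘ₗ TensorProduct.map
        (mul' k H ∘ₗ (TensorProduct.comm k H H).toLinearMap) r.form.val.ofConv ∘ₗ
        (TensorProduct.tensorTensorTensorComm k H H H H).toLinearMap)
      (TensorProduct.assoc k A H H (coact.rTensor H x) ⊗ₜ
        TensorProduct.assoc k A H H (coact.rTensor H y)) := by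
  induction x with
  | zero => simp
  | add x x' hx hx' => simp only [map_add, TensorProduct.add_tmul, hx, hx']
  | tmul b h =>
    induction y with
    | zero => simp
    | add x x' hx hx' => simp only [map_add, TensorProduct.tmul_add, hx, hx']
    | tmul a l =>
      simp only [TensorProduct.tensorTensorTensorComm_tmul, lTensor_tmul, TensorProduct.rid_tmul,
        map_smul, mul'_apply, OpComoduleAlgebra.coact_mul, rTensor_tmul]
      generalize coact (k := k) (H := H) b = u
      generalize coact (k := k) (H := H) a = v
      induction u with
      | zero => simp
      | add x x' hx hx' => simp only [map_add, TensorProduct.add_tmul, smul_add, hx, hx']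
      | tmul b' h' =>
        induction v with
        | zero => simp
        | add x x' hx hx' =>
          simp only [map_add, TensorProduct.add_tmul, TensorProduct.tmul_add, smul_add, hx, hx']
        | tmul a' l' => simp [mulTensor]

theorem coact_opMul_aux2 (x y : A ⊗[k] H) :
    TensorProduct.map (mul' k A ∘ₗ braiding r A A)
      (mul' k H ∘ₗ (TensorProduct.comm k H H).toLinearMap)
      (TensorProduct.tensorTensorTensorComm k A H A H (y ⊗ₜ x)) =
    mulTensor A ((TensorProduct.lid k H).toLinearMap ∘ₗ TensorProduct.map
        r.form.val.ofConv (mul' k H) ∘ₗ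
        (TensorProduct.tensorTensorTensorComm k H H H H).toLinearMap)
      (TensorProduct.assoc k A H H (coact.rTensor H x) ⊗ₜ
        TensorProduct.assoc k A H H (coact.rTensor H y)) := by
  induction x with
  | zero => simp
  | add x x' hx hx' => simp only [map_add, TensorProduct.add_tmul, TensorProduct.tmul_add, hx, hx']
  | tmul b h =>
    induction y with
    | zero => simp
    | add x x' hx hx' =>
      simp only [map_add, TensorProduct.add_tmul, TensorProduct.tmul_add, hx, hx']
    | tmul a l =>
      simp only [TensorProduct.tensorTensorTensorComm_tmul, TensorProduct.map_tmul,
        rTensor_tmul, braiding, LinearMap.comp_apply, LinearEquiv.coe_coe, TensorProduct.comm_tmul]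
      generalize coact (k := k) (H := H) b = u
      generalize coact (k := k) (H := H) a = v
      induction u with
      | zero => simp
      | add x x' hx hx' => simp only [map_add, TensorProduct.add_tmul, hx, hx']
      | tmul b' h' =>
        induction v with
        | zero => simp
        | add x x' hx hx' =>
          simp only [map_add, TensorProduct.add_tmul, TensorProduct.tmul_add, hx, hx']
        | tmul a' l' => simp [mulTensor, TensorProduct.smul_tmul']

theorem coact_opMul (a b : A) :
    coact (mul' k A (braiding r A A (a ⊗ₜ b))) =
      TensorProduct.map (mul' k A ∘ₗ braiding r A A)
        (mul' k H ∘ₗ (TensorProduct.comm k H H).toLinearMap)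
        (TensorProduct.tensorTensorTensorComm k A H A H (coact a ⊗ₜ coact b)) := by
  have hc : ∀ a : A, TensorProduct.assoc k A H H (coact.rTensor H (coact a)) =
      (comul (R := k)).lTensor A (coact a) := fun a =>
    LinearMap.congr_fun (RightComodule.coassoc (k := k) (H := H) (M := A)) a
  rw [coact_opMul_aux2, hc, hc, mulTensor_comul]
  refine (coact_opMul_aux1 r (coact b) (coact a)).trans ?_
  rw [hc, hc, mulTensor_comul]
  congr 2
  exact r.quasi_comm.symm

variable (A)

/-- The underlying space of the opposite algebra `Ā` of an algebra `A` in the category of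
right `H`-comodules; it is `A` as a comodule. -/
def BraidedOpp (_ : UniversalRForm k H) (A : Type*) : Type _ := A

namespace BraidedOpp

instance : AddCommGroup (BraidedOpp r A) := inferInstanceAs (AddCommGroup A)

instance : Module k (BraidedOpp r A) := inferInstanceAs (Module k A)

/-- The identity map `A → Ā`. -/
def of : A ≃ₗ[k] BraidedOpp r A := LinearEquiv.refl k A

instance : RightComodule k H (BraidedOpp r A) := RightComodule.ofEquiv k H (of r A)

/-- The product of `Ā`: `a ∘ b = ∑ b₀ a₀ r(b₁ ⊗ a₁)`. -/
instance : Mul (BraidedOpp r A) :=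
  ⟨fun a b => of r A (mul' k A (braiding r A A ((of r A).symm a ⊗ₜ (of r A).symm b)))⟩

instance : One (BraidedOpp r A) := ⟨of r A 1⟩

variable {A}

theorem mul_def (a b : BraidedOpp r A) : a * b =
    of r A (mul' k A (braiding r A A ((of r A).symm a ⊗ₜ (of r A).symm b))) := rfl

theorem one_def : (1 : BraidedOpp r A) = of r A 1 := rfl

theorem opMul_assoc (a b c : A) :
    mul' k A (braiding r A A (mul' k A (braiding r A A (a ⊗ₜ b)) ⊗ₜ c)) =
      mul' k A (braiding r A A (a ⊗ₜ mul' k A (braiding r A A (b ⊗ₜ c)))) := by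
  have h := braiding_comp_right r (mul' k A ∘ₗ braiding r A A) (coact_opMul r) a b c
  simp only [LinearMap.comp_apply] at h
  rw [h]
  generalize braiding r A A (a ⊗ₜ b) = y
  induction y with
  | zero => simp
  | add x x' hx hx' => simp only [map_add, TensorProduct.add_tmul, hx, hx']
  | tmul b' a' =>
    simp only [mul'_apply, braiding_mul_left, lTensor_tmul, LinearMap.comp_apply,
      LinearMap.flip_apply, TensorProduct.mk_apply]
    generalize braiding r A A (a' ⊗ₜ c) = y
    induction y with
    | zero => simp
    | add x x' hx hx' => simp only [map_add, TensorProduct.tmul_add, hx, hx']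
    | tmul c' a'' =>
      simp only [rTensor_tmul, LinearMap.comp_apply, TensorProduct.mk_apply,
        TensorProduct.assoc_symm_tmul]
      generalize braiding r A A (b' ⊗ₜ c') = y
      induction y with
      | zero => simp
      | add x x' hx hx' =>
        simp only [map_add, TensorProduct.add_tmul, hx, hx']
      | tmul c'' b'' => simp [mul_assoc]

variable (A)

instance : Ring (BraidedOpp r A) :=
  { (inferInstance : AddCommGroup (BraidedOpp r A)), (inferInstance : Mul (BraidedOpp r A)),
    (inferInstance : One (BraidedOpp r A)) with
    left_distrib := fun a b c => by simp [mul_def, TensorProduct.tmul_add]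
    right_distrib := fun a b c => by simp [mul_def, TensorProduct.add_tmul]
    zero_mul := fun a => by simp [mul_def]
    mul_zero := fun a => by simp [mul_def]
    mul_assoc := fun a b c => by
      simp only [mul_def, LinearEquiv.symm_apply_apply]
      rw [opMul_assoc]
    one_mul := fun a => by simp [mul_def, one_def, braiding_one_left]
    mul_one := fun a => by simp [mul_def, one_def, braiding_one_right] }

instance : Algebra k (BraidedOpp r A) :=
  Algebra.ofModule
    (fun t a b => by simp [mul_def, ← TensorProduct.smul_tmul'])
    (fun t a b => by simp [mul_def])

variable {A}

theorem coact_def (a : BraidedOpp r A) : coact (k := k) (H := H) a =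
    (of r A).toLinearMap.rTensor H (coact ((of r A).symm a)) := rfl

set_option synthInstance.maxHeartbeats 200000 in
theorem map_mul_eq (x y : A ⊗[k] H) :
    (of r A).toLinearMap.rTensor H (TensorProduct.map (mul' k A ∘ₗ braiding r A A)
        (mul' k H ∘ₗ (TensorProduct.comm k H H).toLinearMap)
        (TensorProduct.tensorTensorTensorComm k A H A H (x ⊗ₜ y))) =
      TensorProduct.map (mul' k (BraidedOpp r A))
        (mul' k H ∘ₗ (TensorProduct.comm k H H).toLinearMap)
        (TensorProduct.tensorTensorTensorComm k (BraidedOpp r A) H (BraidedOpp r A) H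
          ((of r A).toLinearMap.rTensor H x ⊗ₜ (of r A).toLinearMap.rTensor H y)) := by
  induction x with
  | zero => simp
  | add x x' hx hx' => simp only [map_add, TensorProduct.add_tmul, hx, hx']
  | tmul a l =>
    induction y with
    | zero => simp
    | add x x' hx hx' => simp only [map_add, TensorProduct.tmul_add, hx, hx']
    | tmul b h => simp [mul_def]

variable (A)

/-- `Ā` is again an algebra in the category. -/
instance : OpComoduleAlgebra k H (BraidedOpp r A) where
  coact_one := by simp [coact_def, one_def, OpComoduleAlgebra.coact_one]
  coact_mul := fun a b => by
    simp only [coact_def]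
    rw [← map_mul_eq, mul_def, LinearEquiv.symm_apply_apply, coact_opMul]

end BraidedOpp

end Opposite

section Smash

variable (r : UniversalRForm k H) (A B : Type*) [Ring A] [Algebra k A] [OpComoduleAlgebra k H A]
  [Ring B] [Algebra k B] [OpComoduleAlgebra k H B]

/-- The underlying space `A ⊗ B` of the algebra `A # B`. -/
def Smash (_ : UniversalRForm k H) (A B : Type*) [Ring A] [Algebra k A] [Ring B] [Algebra k B] :
    Type _ := A ⊗[k] B

namespace Smash

instance : AddCommGroup (Smash r A B) := inferInstanceAs (AddCommGroup (A ⊗[k] B))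

instance : Module k (Smash r A B) := inferInstanceAs (Module k (A ⊗[k] B))

/-- The identity map `A ⊗ B → A # B`. -/
def of : A ⊗[k] B ≃ₗ[k] Smash r A B := LinearEquiv.refl k (A ⊗[k] B)

/-- `(a ⊗ b) ⊗ (c ⊗ d) ↦ ∑ a c₀ ⊗ b₀ d r(c₁ ⊗ b₁)`. -/
def smashMul : (A ⊗[k] B) ⊗[k] (A ⊗[k] B) →ₗ[k] A ⊗[k] B :=
  TensorProduct.map (mul' k A) (mul' k B) ∘ₗ
    (TensorProduct.assoc k A A (B ⊗[k] B)).symm.toLinearMap ∘ₗ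
    ((TensorProduct.assoc k A B B).toLinearMap ∘ₗ
      (braiding r B A).rTensor B ∘ₗ
      (TensorProduct.assoc k B A B).symm.toLinearMap).lTensor A ∘ₗ
    (TensorProduct.assoc k A B (A ⊗[k] B)).toLinearMap

variable {A B}

theorem smashMul_tmul (a c : A) (b d : B) : smashMul r A B ((a ⊗ₜ b) ⊗ₜ (c ⊗ₜ d)) =
    TensorProduct.map (LinearMap.mulLeft k a) (LinearMap.mulRight k d)
      (braiding r B A (b ⊗ₜ c)) := by
  simp only [smashMul, LinearMap.comp_apply, LinearEquiv.coe_coe, TensorProduct.assoc_tmul,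
    lTensor_tmul, TensorProduct.assoc_symm_tmul, rTensor_tmul]
  generalize braiding r B A (b ⊗ₜ c) = y
  induction y with
  | zero => simp
  | add x x' hx hx' => simp only [map_add, TensorProduct.add_tmul, TensorProduct.tmul_add, hx, hx']
  | tmul c' b' => simp

theorem smashMul_assoc (x y z : A ⊗[k] B) :
    smashMul r A B (smashMul r A B (x ⊗ₜ y) ⊗ₜ z) =
      smashMul r A B (x ⊗ₜ smashMul r A B (y ⊗ₜ z)) := by
  induction x with
  | zero => simp
  | add x x' hx hx' => simp only [map_add, TensorProduct.add_tmul, hx, hx']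
  | tmul a b =>
  induction y with
  | zero => simp
  | add x x' hx hx' => simp only [map_add, TensorProduct.add_tmul, TensorProduct.tmul_add, hx, hx']
  | tmul c d =>
  induction z with
  | zero => simp
  | add x x' hx hx' => simp only [map_add, TensorProduct.tmul_add, hx, hx']
  | tmul e f =>
  simp only [smashMul_tmul]
  obtain ⟨S, hS⟩ := TensorProduct.exists_finset (braiding r B A (b ⊗ₜ c))
  obtain ⟨T, hT⟩ := TensorProduct.exists_finset (braiding r B A (d ⊗ₜ e))
  rw [hS, hT]
  simp only [map_sum, TensorProduct.sum_tmul, TensorProduct.tmul_sum, TensorProduct.map_tmul,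
    smashMul_tmul, mulLeft_apply, mulRight_apply, braiding_mul_left, braiding_mul_right, hS, hT,
    lTensor_tmul, rTensor_tmul, LinearMap.comp_apply, LinearMap.flip_apply,
    TensorProduct.mk_apply]
  rw [Finset.sum_comm]
  refine Finset.sum_congr rfl fun p _ => Finset.sum_congr rfl fun q _ => ?_
  generalize braiding r B A (q.2 ⊗ₜ p.1) = y
  induction y with
  | zero => simp
  | add x x' hx hx' => simp only [map_add, TensorProduct.add_tmul, TensorProduct.tmul_add, hx, hx']
  | tmul c' b' => simp [mul_assoc]

theorem smashMul_one_left (x : A ⊗[k] B) : smashMul r A B ((1 ⊗ₜ 1) ⊗ₜ x) = x := by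
  induction x with
  | zero => simp
  | add x x' hx hx' => simp only [map_add, TensorProduct.tmul_add, hx, hx']
  | tmul a b => simp [smashMul_tmul, braiding_one_left]

theorem smashMul_one_right (x : A ⊗[k] B) : smashMul r A B (x ⊗ₜ (1 ⊗ₜ 1)) = x := by
  induction x with
  | zero => simp
  | add x x' hx hx' => simp only [map_add, TensorProduct.add_tmul, hx, hx']
  | tmul a b => simp [smashMul_tmul, braiding_one_right]

variable (A B)

/-- The product of `A # B`: `(a # b)(c # d) = ∑ a c₀ # b₀ d r(c₁ ⊗ b₁)`. -/
instance : Mul (Smash r A B) :=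
  ⟨fun x y => of r A B (smashMul r A B ((of r A B).symm x ⊗ₜ (of r A B).symm y))⟩

instance : One (Smash r A B) := ⟨of r A B (1 ⊗ₜ 1)⟩

variable {A B}

theorem mul_def (x y : Smash r A B) :
    x * y = of r A B (smashMul r A B ((of r A B).symm x ⊗ₜ (of r A B).symm y)) := rfl

theorem one_def : (1 : Smash r A B) = of r A B (1 ⊗ₜ 1) := rfl

variable (A B)

instance : Ring (Smash r A B) :=
  { (inferInstance : AddCommGroup (Smash r A B)), (inferInstance : Mul (Smash r A B)),
    (inferInstance : One (Smash r A B)) with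
    left_distrib := fun a b c => by simp [mul_def, TensorProduct.tmul_add]
    right_distrib := fun a b c => by simp [mul_def, TensorProduct.add_tmul]
    zero_mul := fun a => by simp [mul_def]
    mul_zero := fun a => by simp [mul_def]
    mul_assoc := fun a b c => by
      simp only [mul_def, LinearEquiv.symm_apply_apply]
      rw [smashMul_assoc]
    one_mul := fun a => by simp [mul_def, one_def, smashMul_one_left]
    mul_one := fun a => by simp [mul_def, one_def, smashMul_one_right] }

instance : Algebra k (Smash r A B) :=
  Algebra.ofModule
    (fun t a b => by simp [mul_def, ← TensorProduct.smul_tmul'])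
    (fun t a b => by simp [mul_def])

end Smash

end Smash

section Azumaya

variable (r : UniversalRForm k H) {A : Type*} [Ring A] [Algebra k A] [OpComoduleAlgebra k H A]

set_option synthInstance.maxHeartbeats 200000 in
theorem braiding_opp_left {N : Type*} [AddCommGroup N] [Module k N] [RightComodule k H N]
    (b : A) (c : N) : braiding r (BraidedOpp r A) N (BraidedOpp.of r A b ⊗ₜ c) =
      (BraidedOpp.of r A).toLinearMap.lTensor N (braiding r A N (b ⊗ₜ c)) := by
  obtain ⟨S, hS⟩ := exists_coact (k := k) (H := H) b
  have h : coact (BraidedOpp.of r A b) = ∑ p ∈ S, BraidedOpp.of r A p.1 ⊗ₜ[k] p.2 := by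
    rw [BraidedOpp.coact_def, LinearEquiv.symm_apply_apply, hS]
    simp
  rw [braiding_eq_right r _ _ _ _ _ hS, braiding_eq_right r _ _ _ _ _ h]
  simp

set_option synthInstance.maxHeartbeats 200000 in
theorem braiding_opp_right {M : Type*} [AddCommGroup M] [Module k M] [RightComodule k H M]
    (b : M) (c : A) : braiding r M (BraidedOpp r A) (b ⊗ₜ BraidedOpp.of r A c) =
      (BraidedOpp.of r A).toLinearMap.rTensor M (braiding r M A (b ⊗ₜ c)) := by
  obtain ⟨S, hS⟩ := exists_coact (k := k) (H := H) c
  have h : coact (BraidedOpp.of r A c) = ∑ p ∈ S, BraidedOpp.of r A p.1 ⊗ₜ[k] p.2 := by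
    rw [BraidedOpp.coact_def, LinearEquiv.symm_apply_apply, hS]
    simp
  rw [braiding_eq_left r _ _ _ _ _ hS, braiding_eq_left r _ _ _ _ _ h]
  simp

variable (A)

/-- `a ⊗ b ↦ (c ↦ ∑ a c₀ b₀ r(c₁ ⊗ b₁))`. -/
def azumayaFLin : A ⊗[k] BraidedOpp r A →ₗ[k] Module.End k A :=
  TensorProduct.lift (LinearMap.mk₂ k
    (fun a b => LinearMap.mulLeft k a ∘ₗ mul' k A ∘ₗ braiding r A A ∘ₗ
      TensorProduct.mk k A A ((BraidedOpp.of r A).symm b))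
    (fun a a' b => by ext c; simp [add_mul])
    (fun t a b => by ext c; simp)
    (fun a b b' => by ext c; simp [mul_add])
    (fun t a b => by ext c; simp))

/-- `a ⊗ b ↦ (c ↦ ∑ r(a₁ ⊗ c₁) a₀ c₀ b)`. -/
def azumayaGLin : BraidedOpp r A ⊗[k] A →ₗ[k] Module.End k A :=
  TensorProduct.lift (LinearMap.mk₂ k
    (fun a b => LinearMap.mulRight k b ∘ₗ mul' k A ∘ₗ braiding r A A ∘ₗ
      (TensorProduct.mk k A A).flip ((BraidedOpp.of r A).symm a))
    (fun a a' b => by ext c; simp [add_mul])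
    (fun t a b => by ext c; simp)
    (fun a b b' => by ext c; simp [mul_add])
    (fun t a b => by ext c; simp))

variable {A}

theorem azumayaFLin_apply (a : A) (b : BraidedOpp r A) (c : A) :
    azumayaFLin r A (a ⊗ₜ b) c =
      a * mul' k A (braiding r A A ((BraidedOpp.of r A).symm b ⊗ₜ c)) := rfl

theorem azumayaGLin_apply (a : BraidedOpp r A) (b : A) (c : A) :
    azumayaGLin r A (a ⊗ₜ b) c =
      mul' k A (braiding r A A (c ⊗ₜ (BraidedOpp.of r A).symm a)) * b := rfl

theorem azumayaFLin_mul (x y : A ⊗[k] BraidedOpp r A) :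
    azumayaFLin r A (Smash.smashMul r A (BraidedOpp r A) (x ⊗ₜ y)) =
      azumayaFLin r A x * azumayaFLin r A y := by
  induction x with
  | zero => simp
  | add x x' hx hx' => simp only [map_add, TensorProduct.add_tmul, add_mul, hx, hx']
  | tmul a b =>
  induction y with
  | zero => simp
  | add x x' hx hx' => simp only [map_add, TensorProduct.tmul_add, mul_add, hx, hx']
  | tmul c d =>
  obtain ⟨b, rfl⟩ := (BraidedOpp.of r A).surjective b
  ext x
  rw [Smash.smashMul_tmul, braiding_opp_left, Module.End.mul_apply, azumayaFLin_apply,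
    azumayaFLin_apply, LinearEquiv.symm_apply_apply, braiding_mul_right]
  generalize braiding r A A (b ⊗ₜ c) = y
  induction y with
  | zero => simp
  | add x x' hx hx' => simp only [map_add, mul_add, LinearMap.add_apply, hx, hx']
  | tmul c' b' =>
    simp only [lTensor_tmul, TensorProduct.map_tmul, mulLeft_apply, mulRight_apply,
      LinearEquiv.coe_coe, azumayaFLin_apply, BraidedOpp.mul_def, LinearEquiv.symm_apply_apply,
      BraidedOpp.opMul_assoc, LinearMap.comp_apply, LinearMap.flip_apply, TensorProduct.mk_apply]
    generalize braiding r A A (b' ⊗ₜ _) = y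
    induction y with
    | zero => simp
    | add x x' hx hx' => simp only [map_add, TensorProduct.tmul_add, mul_add, hx, hx']
    | tmul c'' b'' => simp [mul_assoc]

theorem azumayaGLin_mul (x y : BraidedOpp r A ⊗[k] A) :
    azumayaGLin r A (Smash.smashMul r (BraidedOpp r A) A (x ⊗ₜ y)) =
      azumayaGLin r A y * azumayaGLin r A x := by
  induction x with
  | zero => simp
  | add x x' hx hx' => simp only [map_add, TensorProduct.add_tmul, mul_add, hx, hx']
  | tmul a b =>
  induction y with
  | zero => simp
  | add x x' hx hx' => simp only [map_add, TensorProduct.tmul_add, add_mul, hx, hx']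
  | tmul c d =>
  obtain ⟨c, rfl⟩ := (BraidedOpp.of r A).surjective c
  ext x
  rw [Smash.smashMul_tmul, braiding_opp_right, Module.End.mul_apply, azumayaGLin_apply,
    azumayaGLin_apply, LinearEquiv.symm_apply_apply, braiding_mul_left]
  generalize braiding r A A (b ⊗ₜ c) = y
  induction y with
  | zero => simp
  | add x x' hx hx' => simp only [map_add, add_mul, LinearMap.add_apply, hx, hx']
  | tmul c' b' =>
    simp only [rTensor_tmul, TensorProduct.map_tmul, mulLeft_apply, mulRight_apply,
      LinearEquiv.coe_coe, azumayaGLin_apply, BraidedOpp.mul_def, LinearEquiv.symm_apply_apply,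
      ← BraidedOpp.opMul_assoc, LinearMap.comp_apply, TensorProduct.mk_apply]
    generalize braiding r A A (_ ⊗ₜ c') = y
    induction y with
    | zero => simp
    | add x x' hx hx' => simp only [map_add, TensorProduct.add_tmul, add_mul, hx, hx']
    | tmul c'' b'' => simp [mul_assoc]

variable (A)

/-- The algebra map `F : A # Ā → End(A)`, `F(a # b)(c) = ∑ a c₀ b₀ r(c₁ ⊗ b₁)`. -/
def azumayaF : Smash r A (BraidedOpp r A) →ₐ[k] Module.End k A :=
  AlgHom.ofLinearMap (azumayaFLin r A ∘ₗ (Smash.of r A (BraidedOpp r A)).symm.toLinearMap)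
    (by
      ext c
      simp [Smash.one_def, BraidedOpp.one_def, azumayaFLin_apply, braiding_one_left])
    (fun x y => by
      simp only [Smash.mul_def, LinearMap.comp_apply, LinearEquiv.coe_coe,
        LinearEquiv.symm_apply_apply, azumayaFLin_mul])

/-- The algebra map `G : Ā # A → End(A)ᵒᵖ`, `G(a # b)(c) = ∑ r(a₁ ⊗ c₁) a₀ c₀ b`. -/
def azumayaG : Smash r (BraidedOpp r A) A →ₐ[k] (Module.End k A)ᵐᵒᵖ :=
  AlgHom.ofLinearMap ((MulOpposite.opLinearEquiv k).toLinearMap ∘ₗ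
      azumayaGLin r A ∘ₗ (Smash.of r (BraidedOpp r A) A).symm.toLinearMap)
    (by
      apply MulOpposite.unop_injective
      ext c
      simp [Smash.one_def, BraidedOpp.one_def, azumayaGLin_apply, braiding_one_right])
    (fun x y => by
      simp only [Smash.mul_def, LinearMap.comp_apply, LinearEquiv.coe_coe,
        LinearEquiv.symm_apply_apply, azumayaGLin_mul, MulOpposite.coe_opLinearEquiv,
        MulOpposite.op_mul])

theorem azumayaF_apply (a : A) (b : BraidedOpp r A) (c : A) :
    azumayaF r A (Smash.of r A (BraidedOpp r A) (a ⊗ₜ b)) c =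
      a * mul' k A (braiding r A A ((BraidedOpp.of r A).symm b ⊗ₜ c)) := rfl

theorem azumayaG_apply (a : BraidedOpp r A) (b : A) (c : A) :
    (azumayaG r A (Smash.of r (BraidedOpp r A) A (a ⊗ₜ b))).unop c =
      mul' k A (braiding r A A (c ⊗ₜ (BraidedOpp.of r A).symm a)) * b := rfl

/-- An algebra `A` in the category of finite-dimensional right `H`-comodules is
`(H, r)`-Azumaya if `F : A # Ā → End(A)` and `G : Ā # A → End(A)ᵒᵖ` are isomorphisms.
(Both maps are always colinear algebra maps, so this means that they are bijective.) -/
def IsAzumaya [FiniteDimensional k A] : Prop :=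
  Function.Bijective (azumayaF r A) ∧ Function.Bijective (azumayaG r A)

end Azumaya

section Cleft

/-- The product `h ⊗ l ↦ ∑ σ(h₁ ⊗ l₁) h₂ l₂` of the crossed product `_σ H = k #_σ H`. -/
def crossedMul (σ : LeftTwoCocycle k H) : H ⊗[k] H →ₗ[k] H :=
  convSMul σ.form.val.ofConv (mul' k H)

section helpers
variable {C D N P : Type*} [AddCommGroup C] [Module k C] [Coalgebra k C]
  [AddCommGroup D] [Module k D] [Coalgebra k D]
    [AddCommGroup N] [Module k N] [AddCommGroup P] [Module k P]

theorem convSMul_repr {ι : Type*} {c : C} (R : Coalgebra.Repr k c ι) (f : C →ₗ[k] k)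
    (g : C →ₗ[k] N) :
    convSMul f g c = ∑ i ∈ R.index, f (R.left i) • g (R.right i) := by
  simp [convSMul, ← R.eq]

theorem convSMul_comp (f : C →ₗ[k] k) (g : C →ₗ[k] N) (π : D →ₗc[k] C) :
    convSMul f g ∘ₗ π.toLinearMap = convSMul (f ∘ₗ π.toLinearMap) (g ∘ₗ π.toLinearMap) := by
  ext x
  have := CoalgHomClass.map_comp_comul_apply π x
  simp only [convSMul, LinearMap.comp_apply]
  rw [TensorProduct.map_comp, LinearMap.comp_apply]
  congr 2
  exact this.symm

theorem comp_convSMul (f : C →ₗ[k] k) (g : C →ₗ[k] N) (φ : N →ₗ[k] P) :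
    φ ∘ₗ convSMul f g = convSMul f (φ ∘ₗ g) := by
  ext x
  simp [convSMul_repr (ℛ k x)]

theorem convSMul_convSMul (f f' : C →ₗ[k] k) (g : C →ₗ[k] N) :
    convSMul f (convSMul f' g) = convSMul (convSMul f f') g := by
  ext x
  have h := congr(TensorProduct.lid k N (TensorProduct.map f ((TensorProduct.lid k N).toLinearMap ∘ₗ
    TensorProduct.map f' g) $(Coalgebra.coassoc_apply (R := k) x)))
  have h2 : convSMul f (convSMul f' g) x = TensorProduct.lid k N (TensorProduct.map f
      ((TensorProduct.lid k N).toLinearMap ∘ₗ TensorProduct.map f' g)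
      ((comul (R := k)).lTensor C (comul x))) := by
    rw [← (ℛ k x).eq]
    simp only [convSMul_repr (ℛ k x), map_sum]
    simp [convSMul]
  have h3 : convSMul (convSMul f f') g x = TensorProduct.lid k N (TensorProduct.map f
      ((TensorProduct.lid k N).toLinearMap ∘ₗ TensorProduct.map f' g)
      (TensorProduct.assoc k C C C ((comul (R := k)).rTensor C (comul x)))) := by
    rw [← (ℛ k x).eq]
    simp only [convSMul_repr (ℛ k x), map_sum, LinearMap.rTensor_tmul]
    refine Finset.sum_congr rfl fun i _ => ?_
    rw [convSMul_repr (ℛ k ((ℛ k x).left i)), ← (ℛ k ((ℛ k x).left i)).eq]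
    simp [TensorProduct.sum_tmul, Finset.sum_smul, mul_smul, smul_comm (f' _)]
  rw [h2, h3, h]

theorem convSMul_rTensor (f : C →ₗ[k] k) (g : C →ₗ[k] N) :
    (convSMul f g).rTensor D = convSMul
      ((TensorProduct.lid k k).toLinearMap ∘ₗ TensorProduct.map f counit)
      (g.rTensor D) := by
  ext x y
  simp only [TensorProduct.AlgebraTensorModule.curry_apply, TensorProduct.curry_apply,
    LinearMap.coe_restrictScalars, LinearMap.rTensor_tmul]
  conv_lhs => rw [← sum_counit_smul (ℛ k y)]
  rw [convSMul_repr (ℛ k x)]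
  simp only [convSMul, LinearMap.comp_apply, TensorProduct.comul_tmul]
  rw [← (ℛ k x).eq, ← (ℛ k y).eq]
  simp only [TensorProduct.sum_tmul, TensorProduct.tmul_sum, map_sum]
  simp [← TensorProduct.smul_tmul', mul_smul, smul_comm (f _)]

theorem convSMul_lTensor (f : C →ₗ[k] k) (g : C →ₗ[k] N) :
    (convSMul f g).lTensor D = convSMul
      ((TensorProduct.lid k k).toLinearMap ∘ₗ TensorProduct.map counit f)
      (g.lTensor D) := by
  ext y x
  simp only [TensorProduct.AlgebraTensorModule.curry_apply, TensorProduct.curry_apply,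
    LinearMap.coe_restrictScalars, LinearMap.lTensor_tmul]
  conv_lhs => rw [← sum_counit_smul (ℛ k y)]
  rw [convSMul_repr (ℛ k x)]
  simp only [convSMul, LinearMap.comp_apply, TensorProduct.comul_tmul]
  rw [← (ℛ k x).eq, ← (ℛ k y).eq]
  simp only [TensorProduct.sum_tmul, TensorProduct.tmul_sum, map_sum]
  simp [← TensorProduct.smul_tmul', mul_smul, smul_comm (f _)]

end helpers

variable (σ : LeftTwoCocycle k H)

theorem crossedMul_one_left (x : H) : crossedMul σ (1 ⊗ₜ x) = x := by
  simp only [crossedMul, convSMul, LinearMap.comp_apply, TensorProduct.comul_tmul,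
    Bialgebra.comul_one, Algebra.TensorProduct.one_def]
  rw [← (ℛ k x).eq]
  simp [TensorProduct.tmul_sum, σ.apply_one_left]

theorem crossedMul_one_right (x : H) : crossedMul σ (x ⊗ₜ 1) = x := by
  simp only [crossedMul, convSMul, LinearMap.comp_apply, TensorProduct.comul_tmul,
    Bialgebra.comul_one, Algebra.TensorProduct.one_def]
  rw [← (ℛ k x).eq]
  simp [TensorProduct.sum_tmul, σ.apply_one_right]

theorem cocycle_crossedMul (x y z : H) :
    σ.form.val.ofConv (crossedMul σ (x ⊗ₜ y) ⊗ₜ z) =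
      σ.form.val.ofConv (x ⊗ₜ crossedMul σ (y ⊗ₜ z)) := by
  have h := σ.cocycle x y z
  rw [← comp_convSMul, ← comp_convSMul] at h
  exact h.symm

theorem crossedMul_assoc (x y z : H) :
    crossedMul σ (crossedMul σ (x ⊗ₜ y) ⊗ₜ z) = crossedMul σ (x ⊗ₜ crossedMul σ (y ⊗ₜ z)) := by
  let s := σ.form.val.ofConv
  let πl : (H ⊗[k] H) ⊗[k] H →ₗc[k] H ⊗[k] H :=
    CoalgHom.rTensor H (Bialgebra.mulCoalgHom k H)
  let πr : H ⊗[k] (H ⊗[k] H) →ₗc[k] H ⊗[k] H :=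
    CoalgHom.lTensor H (Bialgebra.mulCoalgHom k H)
  let α : (H ⊗[k] H) ⊗[k] H →ₗc[k] H ⊗[k] (H ⊗[k] H) :=
    (Coalgebra.TensorProduct.assoc k k H H H).toCoalgHom
  have hl : crossedMul σ ∘ₗ (crossedMul σ).rTensor H =
      convSMul (s ∘ₗ (crossedMul σ).rTensor H) (mul' k H ∘ₗ (mul' k H).rTensor H) := by
    conv_lhs => enter [2]; rw [crossedMul, convSMul_rTensor]
    rw [comp_convSMul]
    have : crossedMul σ ∘ₗ (mul' k H).rTensor H =
      convSMul (s ∘ₗ (mul' k H).rTensor H) (mul' k H ∘ₗ (mul' k H).rTensor H) :=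
      convSMul_comp s (mul' k H) πl
    rw [this, convSMul_convSMul, ← comp_convSMul _ _ s, crossedMul, convSMul_rTensor]
  have hr : crossedMul σ ∘ₗ (crossedMul σ).lTensor H =
      convSMul (s ∘ₗ (crossedMul σ).lTensor H) (mul' k H ∘ₗ (mul' k H).lTensor H) := by
    conv_lhs => enter [2]; rw [crossedMul, convSMul_lTensor]
    rw [comp_convSMul]
    have : crossedMul σ ∘ₗ (mul' k H).lTensor H =
      convSMul (s ∘ₗ (mul' k H).lTensor H) (mul' k H ∘ₗ (mul' k H).lTensor H) :=
      convSMul_comp s (mul' k H) πr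
    rw [this, convSMul_convSMul, ← comp_convSMul _ _ s, crossedMul, convSMul_lTensor]
  have hα := convSMul_comp (s ∘ₗ (crossedMul σ).lTensor H) (mul' k H ∘ₗ (mul' k H).lTensor H) α
  have h1 : s ∘ₗ (crossedMul σ).rTensor H = (s ∘ₗ (crossedMul σ).lTensor H) ∘ₗ α.toLinearMap := by
    ext a b c
    exact cocycle_crossedMul σ a b c
  have h2 : mul' k H ∘ₗ (mul' k H).rTensor H =
      (mul' k H ∘ₗ (mul' k H).lTensor H) ∘ₗ α.toLinearMap := by
    ext a b c
    exact mul_assoc a b c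
  have h3 : crossedMul σ ∘ₗ (crossedMul σ).rTensor H =
      (crossedMul σ ∘ₗ (crossedMul σ).lTensor H) ∘ₗ α.toLinearMap := by
    rw [hl, hr, hα, h1, h2]
  exact LinearMap.congr_fun h3 ((x ⊗ₜ y) ⊗ₜ z)

theorem comul_crossedMul (x y : H) :
    comul (R := k) (crossedMul σ (x ⊗ₜ y)) =
      TensorProduct.map (crossedMul σ) (mul' k H)
        (TensorProduct.tensorTensorTensorComm k H H H H (comul x ⊗ₜ comul y)) := by
  have hμ : comul ∘ₗ mul' k H = TensorProduct.map (mul' k H) (mul' k H) ∘ₗ comul :=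
    (Bialgebra.mulCoalgHom k H).map_comp_comul.symm
  have h1 : comul (R := k) ∘ₗ crossedMul σ =
      convSMul σ.form.val.ofConv (TensorProduct.map (mul' k H) (mul' k H) ∘ₗ comul) := by
    rw [crossedMul, comp_convSMul, hμ]
  have h2 : ∀ c : H ⊗[k] H,
      convSMul σ.form.val.ofConv (TensorProduct.map (mul' k H) (mul' k H) ∘ₗ comul) c =
        TensorProduct.map (crossedMul σ) (mul' k H) (comul c) := by
    intro c
    have h := congr(TensorProduct.lid k _ (TensorProduct.map σ.form.val.ofConv
      (TensorProduct.map (mul' k H) (mul' k H)) $(Coalgebra.coassoc_apply (R := k) c)))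
    rw [← (ℛ k c).eq] at h ⊢
    simp only [map_sum, LinearMap.rTensor_tmul, LinearMap.lTensor_tmul,
      TensorProduct.map_tmul, TensorProduct.lid_tmul] at h
    rw [convSMul_repr (ℛ k c)]
    simp only [map_sum, TensorProduct.map_tmul, LinearMap.comp_apply]
    rw [← h]
    refine Finset.sum_congr rfl fun i _ => ?_
    rw [crossedMul, convSMul_repr (ℛ k ((ℛ k c).left i)), ← (ℛ k ((ℛ k c).left i)).eq]
    simp [TensorProduct.sum_tmul, TensorProduct.smul_tmul']
  have h3 := LinearMap.congr_fun h1 (x ⊗ₜ y)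
  rw [h2] at h3
  exact h3

/-- The underlying space of `A_σ = _{στ}(Hᵒᵖ)`. -/
def Cleft (_ : LeftTwoCocycle k H) : Type _ := H

namespace Cleft

instance : AddCommGroup (Cleft σ) := inferInstanceAs (AddCommGroup H)

instance : Module k (Cleft σ) := inferInstanceAs (Module k H)

instance [FiniteDimensional k H] : FiniteDimensional k (Cleft σ) :=
  inferInstanceAs (FiniteDimensional k H)

/-- The identity map `H → A_σ`. -/
def of : H ≃ₗ[k] Cleft σ := LinearEquiv.refl k H

/-- The product of `A_σ`: `h · l = ∑ σ(l₁ ⊗ h₁) l₂ h₂`. -/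
instance : Mul (Cleft σ) :=
  ⟨fun a b => of σ (crossedMul σ ((of σ).symm b ⊗ₜ (of σ).symm a))⟩

instance : One (Cleft σ) := ⟨of σ 1⟩

theorem mul_def (a b : Cleft σ) :
    a * b = of σ (crossedMul σ ((of σ).symm b ⊗ₜ (of σ).symm a)) := rfl

theorem one_def : (1 : Cleft σ) = of σ 1 := rfl

instance : Ring (Cleft σ) :=
  { (inferInstance : AddCommGroup (Cleft σ)), (inferInstance : Mul (Cleft σ)),
    (inferInstance : One (Cleft σ)) with
    left_distrib := fun a b c => by simp [mul_def, TensorProduct.add_tmul]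
    right_distrib := fun a b c => by simp [mul_def, TensorProduct.tmul_add]
    zero_mul := fun a => by simp [mul_def]
    mul_zero := fun a => by simp [mul_def]
    mul_assoc := fun a b c => by
      simp only [mul_def, LinearEquiv.symm_apply_apply]
      rw [crossedMul_assoc]
    one_mul := fun a => by simp [mul_def, one_def, crossedMul_one_right]
    mul_one := fun a => by simp [mul_def, one_def, crossedMul_one_left] }

instance : Algebra k (Cleft σ) :=
  Algebra.ofModule
    (fun t a b => by simp [mul_def])
    (fun t a b => by simp [mul_def, ← TensorProduct.smul_tmul'])

/-- The regular right comodule `H`, with the coproduct as coaction. -/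
abbrev regularComodule : RightComodule k H H where
  coact := comul
  coassoc := Coalgebra.coassoc
  counit_coact := by
    ext a
    simp

/-- The right `H`-comodule structure of `A_σ`, given by the coproduct of `H`. -/
instance : RightComodule k H (Cleft σ) :=
  letI : RightComodule k H H := regularComodule
  RightComodule.ofEquiv k H (of σ)

theorem coact_def (a : Cleft σ) : coact (k := k) (H := H) a =
    (of σ).toLinearMap.rTensor H (comul ((of σ).symm a)) := rfl

/-- `A_σ` is a right `Hᵒᵖ`-comodule algebra. -/
instance : OpComoduleAlgebra k H (Cleft σ) where
  coact_one := by
    simp [coact_def, one_def, Algebra.TensorProduct.one_def]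
  coact_mul := fun a b => by
    simp only [coact_def, mul_def, LinearEquiv.symm_apply_apply, comul_crossedMul]
    rw [← (ℛ k ((of σ).symm a)).eq, ← (ℛ k ((of σ).symm b)).eq]
    simp only [TensorProduct.sum_tmul, TensorProduct.tmul_sum, map_sum]
    rw [Finset.sum_comm]
    simp [mul_def]

end Cleft

/-- The form `r_σ = (στ) * r * σ⁻¹`. -/
def twistedRForm (r : UniversalRForm k H) : ConvForm k H :=
  toConv (σ.form.val.ofConv ∘ₗ (TensorProduct.comm k H H).toLinearMap) * r.form.val *
    (σ.form⁻¹).val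

/-- The map `θ_σ : h ↦ r_σ(- ⊗ h)`. (The twisted Hopf algebra `_σ H_{σ⁻¹}` and its opposite
have `H` as underlying vector space, so `θ_σ` is a linear map from `H` to its dual.) -/
def theta (r : UniversalRForm k H) : H →ₗ[k] Module.Dual k H :=
  (TensorProduct.curry (twistedRForm σ r).ofConv).flip

end Cleft

end CleftAzumaya

end

/-! Write `γ` for the identity map `H → A_σ`. Quasi-commutativity of `r` turns the twisted product
occurring in `F` and `G` into the product of `A_σ` weighted by `r_σ`: `(στ * μᵒᵖ) * r = στ * r * μ =
r_σ * (σ * μ)`, where `μ` is the multiplication of `H` (`smulConv_crossedMul_comm`, `mul_braiding`).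
Hence `F(a # b)(c) = ∑ r_σ(c₁ ⊗ b₁) a γ(b₂) γ(c₂)`.

This formula factors `F` into `a ⊗ b ↦ ∑ a γ(b₂) ⊗ b₁`, then `θ_σ` on the second leg, then the
canonical isomorphism `A ⊗ H* ≅ Hom(H, A)`, then right convolution by `γ` (`comparison`). The first
and last factors are bijective once `γ` is convolution invertible both in `Hom(H, A_σᵒᵖ)` and in
`Hom(H, A_σ)`. Tensoring with the nonzero space `A_σ` over a field preserves and reflects
bijectivity, so `F` is bijective exactly when `θ_σ` is (`comparison_bijective_iff`). The same
argument over `A_σᵒᵖ` shows that `G` is bijective exactly when the transpose of `θ_σ` is, and in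
finite dimension the two conditions agree.

It remains to invert `γ`. The convolution algebras are finite-dimensional, so it suffices that `φ *
γ = 0` forces `φ = 0`. Up to the invertible action of `σ`, this follows from injectivity of the
Galois map of `H` with its usual or opposite multiplication (`eq_zero_of_convSMul_comp`). The usual
one is handled by the antipode. The opposite one needs an inverse of the identity in `Hom(H, Hᵒᵖ)`,
that is, a skew antipode; it comes from the Drinfeld functional `v(x) = ∑ r(x₂ ⊗ S(x₁))`, which is
invertible and satisfies `S * v * id = v` in `Hom(H, Hᵒᵖ)` (`isUnit_drinfeld`, `isUnit_opConv_id`).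
-/

noncomputable section

set_option linter.unusedSectionVars false

namespace CleftAzumaya

open scoped TensorProduct
open Coalgebra LinearMap WithConv

/-! ### One-sided criteria for units in finite-dimensional algebras -/

section FiniteDimensionalAlgebra

theorem isUnit_of_forall_mul_eq_zero (k : Type*) {B : Type*} [Field k] [Ring B] [Algebra k B]
    [FiniteDimensional k B] {b : B} (h : ∀ x : B, x * b = 0 → x = 0) : IsUnit b := by
  have hinj : Function.Injective (LinearMap.mulRight k b) :=
    (injective_iff_map_eq_zero _).2 fun x hx => h x hx
  obtain ⟨a, ha⟩ := LinearMap.injective_iff_surjective.1 hinj 1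
  rw [mulRight_apply] at ha
  refine ⟨⟨b, a, ?_, ha⟩, rfl⟩
  -- Right multiplication by `b` is injective, so `b * a = 1` may be checked after multiplying by
  -- `b`, where it follows from `a * b = 1`.
  refine hinj ?_
  simp [mul_assoc, ha]

theorem isUnit_of_mul_eq_one_left (k : Type*) {B : Type*} [Field k] [Ring B] [Algebra k B]
    [FiniteDimensional k B] {a b : B} (h : a * b = 1) : IsUnit b := by
  have hinj : Function.Injective (LinearMap.mulLeft k b) := by
    refine (injective_iff_map_eq_zero _).2 fun x hx => ?_
    rw [mulLeft_apply] at hx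
    rw [← one_mul x, ← h, mul_assoc, hx, mul_zero]
  obtain ⟨c, hc⟩ := LinearMap.injective_iff_surjective.1 hinj 1
  rw [mulLeft_apply] at hc
  exact ⟨⟨b, a, by rw [left_inv_eq_right_inv h hc, hc], h⟩, rfl⟩

end FiniteDimensionalAlgebra

/-! ### Convolution algebras and their actions on `A ⊗ C` -/

section Convolution

variable {k : Type*} [Field k] {C A : Type*} [AddCommGroup C] [Module k C] [Coalgebra k C]
  [Ring A] [Algebra k A]

instance [FiniteDimensional k C] [FiniteDimensional k A] :
    FiniteDimensional k (WithConv (C →ₗ[k] A)) :=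
  Module.Finite.equiv (WithConv.linearEquiv k (C →ₗ[k] A)).symm

variable (A) in
/-- Functionals on a coalgebra, seen as linear maps into an algebra. -/
def scalarConv : WithConv (C →ₗ[k] k) →+* WithConv (C →ₗ[k] A) where
  toFun f := toConv (Algebra.linearMap k A ∘ₗ f.ofConv)
  map_one' := by
    ext c
    simp
  map_mul' f g := by
    ext c
    simp [(ℛ k c).convMul_apply]
  map_zero' := by
    ext c
    simp
  map_add' f g := by
    ext c
    simp

theorem scalarConv_apply (f : WithConv (C →ₗ[k] k)) (c : C) :
    scalarConv A f c = algebraMap k A (f c) := rfl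

theorem toConv_convSMul (f : C →ₗ[k] k) (g : C →ₗ[k] A) :
    toConv (convSMul f g) = scalarConv A (toConv f) * toConv g := by
  ext c
  rw [(ℛ k c).convMul_apply]
  simp [convSMul_repr (ℛ k c), scalarConv_apply, Algebra.smul_def]

theorem smulConv_repr {N ι : Type*} [AddCommGroup N] [Module k N] {c : C}
    (R : Coalgebra.Repr k c ι) (g : C →ₗ[k] N) (f : C →ₗ[k] k) :
    smulConv g f c = ∑ i ∈ R.index, f (R.right i) • g (R.left i) := by
  simp [smulConv, ← R.eq]

theorem toConv_smulConv (g : C →ₗ[k] A) (f : C →ₗ[k] k) :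
    toConv (smulConv g f) = toConv g * scalarConv A (toConv f) := by
  ext c
  rw [(ℛ k c).convMul_apply]
  simp [smulConv_repr (ℛ k c), scalarConv_apply, Algebra.smul_def, Algebra.commutes]

/-- `a ⊗ c ↦ ∑ a φ(c₁) ⊗ c₂`. -/
def translate (φ : WithConv (C →ₗ[k] A)) : A ⊗[k] C →ₗ[k] A ⊗[k] C :=
  (mul' k A ∘ₗ φ.ofConv.lTensor A).rTensor C ∘ₗ
    (TensorProduct.assoc k A C C).symm.toLinearMap ∘ₗ comul.lTensor A

theorem translate_repr {ι : Type*} (φ : WithConv (C →ₗ[k] A)) (a : A) {c : C}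
    (R : Coalgebra.Repr k c ι) :
    translate φ (a ⊗ₜ c) = ∑ i ∈ R.index, (a * φ (R.left i)) ⊗ₜ R.right i := by
  simp [translate, ← R.eq, TensorProduct.tmul_sum]

/-- By coassociativity `translate` is a right action of the convolution algebra, so units act
bijectively. -/
theorem translate_translate (φ ψ : WithConv (C →ₗ[k] A)) (x : A ⊗[k] C) :
    translate ψ (translate φ x) = translate (φ * ψ) x := by
  induction x with
  | zero => simp
  | add x y hx hy => simp only [map_add, hx, hy]
  | tmul a c =>
    let f : C ⊗[k] (C ⊗[k] C) →ₗ[k] A ⊗[k] C :=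
      (LinearMap.mulLeft k a ∘ₗ mul' k A).rTensor C ∘ₗ
        (TensorProduct.assoc k A A C).symm.toLinearMap ∘ₗ
        TensorProduct.map φ.ofConv (ψ.ofConv.rTensor C)
    have h := congr(f $(Coalgebra.coassoc_apply (R := k) c))
    rw [translate_repr _ _ (ℛ k c), translate_repr _ _ (ℛ k c), map_sum]
    simp only [translate_repr _ _ (ℛ k _), (ℛ k _).convMul_apply]
    rw [← (ℛ k c).eq] at h
    simp only [map_sum, rTensor_tmul, lTensor_tmul] at h
    refine Eq.trans ?_ (h.symm.trans ?_)
    · refine Finset.sum_congr rfl fun i _ => ?_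
      rw [← (ℛ k ((ℛ k c).right i)).eq]
      simp [f, TensorProduct.tmul_sum, mul_assoc]
    · refine Finset.sum_congr rfl fun i _ => ?_
      rw [← (ℛ k ((ℛ k c).left i)).eq]
      simp [f, TensorProduct.sum_tmul, Finset.mul_sum]

theorem translate_one (x : A ⊗[k] C) : translate (1 : WithConv (C →ₗ[k] A)) x = x := by
  induction x with
  | zero => simp
  | add x y hx hy => simp only [map_add, hx, hy]
  | tmul a c =>
    rw [translate_repr _ _ (ℛ k c)]
    conv_rhs => rw [← sum_counit_smul (ℛ k c)]
    simp [TensorProduct.tmul_sum, ← Algebra.commutes, ← Algebra.smul_def, TensorProduct.smul_tmul]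

theorem translate_bijective {φ : WithConv (C →ₗ[k] A)} (h : IsUnit φ) :
    Function.Bijective (translate φ) := by
  obtain ⟨u, rfl⟩ := h
  refine Function.bijective_iff_has_inverse.2 ⟨translate (u⁻¹).val, fun x => ?_, fun x => ?_⟩
  · rw [translate_translate, Units.mul_inv, translate_one]
  · rw [translate_translate, Units.inv_mul, translate_one]

/-- `a ⊗ c ↦ ∑ a φ(c₂) ⊗ c₁`. -/
def cotranslate (φ : WithConv (C →ₗ[k] Aᵐᵒᵖ)) : A ⊗[k] C →ₗ[k] A ⊗[k] C :=
  (mul' k A ∘ₗ ((MulOpposite.opLinearEquiv k).symm.toLinearMap ∘ₗ φ.ofConv).lTensor A).rTensor C ∘ₗ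
    (TensorProduct.assoc k A C C).symm.toLinearMap ∘ₗ
    ((TensorProduct.comm k C C).toLinearMap ∘ₗ comul).lTensor A

theorem cotranslate_repr {ι : Type*} (φ : WithConv (C →ₗ[k] Aᵐᵒᵖ)) (a : A) {c : C}
    (R : Coalgebra.Repr k c ι) :
    cotranslate φ (a ⊗ₜ c) = ∑ i ∈ R.index, (a * (φ (R.right i)).unop) ⊗ₜ R.left i := by
  simp [cotranslate, ← R.eq, TensorProduct.tmul_sum]

/-- Both sides are `∑ a ψ(c₃) φ(c₂) ⊗ c₁`. Since the factors appear in reverse order, the relevant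
convolution algebra takes values in `Aᵐᵒᵖ`, and it acts from the left. -/
theorem cotranslate_cotranslate (φ ψ : WithConv (C →ₗ[k] Aᵐᵒᵖ)) (x : A ⊗[k] C) :
    cotranslate φ (cotranslate ψ x) = cotranslate (φ * ψ) x := by
  induction x with
  | zero => simp
  | add x y hx hy => simp only [map_add, hx, hy]
  | tmul a c =>
    let f : C ⊗[k] (C ⊗[k] C) →ₗ[k] A ⊗[k] C :=
      (TensorProduct.comm k C A).toLinearMap ∘ₗ
      (LinearMap.mulLeft k a ∘ₗ (MulOpposite.opLinearEquiv k).symm.toLinearMap ∘ₗ mul' k Aᵐᵒᵖ ∘ₗ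
        TensorProduct.map φ.ofConv ψ.ofConv).lTensor C
    have h := congr(f $(Coalgebra.coassoc_apply (R := k) c))
    rw [cotranslate_repr _ _ (ℛ k c), cotranslate_repr _ _ (ℛ k c), map_sum]
    simp only [cotranslate_repr _ _ (ℛ k _), (ℛ k _).convMul_apply]
    rw [← (ℛ k c).eq] at h
    simp only [map_sum, rTensor_tmul, lTensor_tmul] at h
    refine Eq.trans ?_ (h.trans ?_)
    · refine Finset.sum_congr rfl fun i _ => ?_
      rw [← (ℛ k ((ℛ k c).left i)).eq]
      simp [f, TensorProduct.sum_tmul, mul_assoc]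
    · refine Finset.sum_congr rfl fun i _ => ?_
      rw [← (ℛ k ((ℛ k c).right i)).eq]
      simp [f, TensorProduct.tmul_sum, Finset.mul_sum, TensorProduct.sum_tmul]

theorem cotranslate_one (x : A ⊗[k] C) : cotranslate (1 : WithConv (C →ₗ[k] Aᵐᵒᵖ)) x = x := by
  induction x with
  | zero => simp
  | add x y hx hy => simp only [map_add, hx, hy]
  | tmul a c =>
    have hc : ∑ i ∈ (ℛ k c).index, counit (R := k) ((ℛ k c).right i) • (ℛ k c).left i = c := by
      have := congr(TensorProduct.rid k C $(sum_tmul_counit_eq (ℛ k c)))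
      simpa only [map_sum, TensorProduct.rid_tmul, one_smul] using this
    rw [cotranslate_repr _ _ (ℛ k c)]
    conv_rhs => rw [← hc]
    simp [TensorProduct.tmul_sum, ← Algebra.commutes, ← Algebra.smul_def, TensorProduct.smul_tmul]

theorem cotranslate_bijective {φ : WithConv (C →ₗ[k] Aᵐᵒᵖ)} (h : IsUnit φ) :
    Function.Bijective (cotranslate φ) := by
  obtain ⟨u, rfl⟩ := h
  refine Function.bijective_iff_has_inverse.2 ⟨cotranslate (u⁻¹).val, fun x => ?_, fun x => ?_⟩
  · rw [cotranslate_cotranslate, Units.inv_mul, cotranslate_one]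
  · rw [cotranslate_cotranslate, Units.mul_inv, cotranslate_one]

end Convolution

/-! ### Galois maps and cancellation of a convolution factor -/

section Galois

variable {k : Type*} [Field k] {C : Type*} [AddCommGroup C] [Module k C] [Coalgebra k C]

/-- `x ⊗ y ↦ ∑ m(x ⊗ y₁) ⊗ y₂`. -/
def galois (m : C ⊗[k] C →ₗ[k] C) : C ⊗[k] C →ₗ[k] C ⊗[k] C :=
  m.rTensor C ∘ₗ (TensorProduct.assoc k C C C).symm.toLinearMap ∘ₗ comul.lTensor C

theorem galois_repr {ι : Type*} (m : C ⊗[k] C →ₗ[k] C) (x : C) {y : C}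
    (R : Coalgebra.Repr k y ι) :
    galois m (x ⊗ₜ y) = ∑ i ∈ R.index, m (x ⊗ₜ R.left i) ⊗ₜ R.right i := by
  simp [galois, ← R.eq, TensorProduct.tmul_sum]

theorem convSMul_tmul {N ι : Type*} [AddCommGroup N] [Module k N] (s : C ⊗[k] C →ₗ[k] k)
    (g : C ⊗[k] C →ₗ[k] N) {x : C} (R : Coalgebra.Repr k x ι) (y : C) :
    convSMul s g (x ⊗ₜ y) = ∑ i ∈ R.index, convSMul (TensorProduct.curry s (R.left i))
      (TensorProduct.curry g (R.right i)) y := by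
  simp only [convSMul, LinearMap.comp_apply, TensorProduct.comul_tmul]
  rw [← R.eq, ← (ℛ k y).eq]
  simp only [TensorProduct.sum_tmul, TensorProduct.tmul_sum, map_sum]
  rw [Finset.sum_comm]
  simp

theorem convSMul_rTensor_comul {N : Type*} [AddCommGroup N] [Module k N] (f : C →ₗ[k] k)
    (g : C →ₗ[k] N) :
    (convSMul f g).rTensor C ∘ₗ comul = convSMul f (g.rTensor C ∘ₗ comul) := by
  ext c
  have h := congr(TensorProduct.lid k (N ⊗[k] C) (TensorProduct.map f (g.rTensor C)
    $(Coalgebra.coassoc_apply (R := k) c)))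
  rw [convSMul_repr (ℛ k c), LinearMap.comp_apply]
  rw [← (ℛ k c).eq] at h ⊢
  simp only [map_sum, rTensor_tmul, lTensor_tmul, TensorProduct.map_tmul,
    TensorProduct.lid_tmul] at h ⊢
  refine Eq.trans (Finset.sum_congr rfl fun i _ => ?_) h
  rw [convSMul_repr (ℛ k ((ℛ k c).left i)), ← (ℛ k ((ℛ k c).left i)).eq]
  simp [TensorProduct.sum_tmul, TensorProduct.smul_tmul']

/-- The scalar `s` uses the first components of both arguments, while the Galois map splits off the
last component of the second, so by coassociativity the two do not interfere. Twisting a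
multiplication by an invertible form therefore keeps its Galois map injective. -/
theorem galois_convSMul (s : C ⊗[k] C →ₗ[k] k) (m : C ⊗[k] C →ₗ[k] C) :
    galois (convSMul s m) = galois m ∘ₗ convSMul s LinearMap.id := by
  rw [comp_convSMul, LinearMap.comp_id]
  ext x y
  have hg : ∀ (m : C ⊗[k] C →ₗ[k] C) (x : C), TensorProduct.curry (galois m) x =
      (TensorProduct.curry m x).rTensor C ∘ₗ comul := by
    intro m x
    ext y
    simp [galois_repr m x (ℛ k y), ← (ℛ k y).eq]
  have hs : TensorProduct.curry (convSMul s m) x = ∑ i ∈ (ℛ k x).index,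
      convSMul (TensorProduct.curry s ((ℛ k x).left i))
        (TensorProduct.curry m ((ℛ k x).right i)) := by
    ext y
    simp [convSMul_tmul s m (ℛ k x)]
  refine Eq.trans (LinearMap.congr_fun (hg _ x) y) ?_
  refine Eq.trans ?_ (convSMul_tmul s (galois m) (ℛ k x) y).symm
  simp only [hg, hs, ← convSMul_rTensor_comul]
  simp [← LinearMap.coe_rTensorHom, map_sum]

theorem galois_rTensor_comul (m : C ⊗[k] C →ₗ[k] C) (φ : C →ₗ[k] C) :
    galois m ∘ₗ φ.rTensor C ∘ₗ comul = (m ∘ₗ φ.rTensor C ∘ₗ comul).rTensor C ∘ₗ comul := by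
  ext c
  have h := congr(m.rTensor C ((φ.rTensor C).rTensor C
    $(Coalgebra.coassoc_symm_apply (R := k) c)))
  rw [← (ℛ k c).eq] at h
  simp only [LinearMap.comp_apply]
  rw [← (ℛ k c).eq]
  simp only [map_sum, rTensor_tmul, lTensor_tmul] at h ⊢
  refine Eq.trans (Finset.sum_congr rfl fun i _ => ?_) (h.trans ?_)
  · rw [galois_repr m _ (ℛ k _), ← (ℛ k ((ℛ k c).right i)).eq]
    simp [TensorProduct.tmul_sum]
  · simp

/-- The hypothesis says that `φ * id` vanishes for the twisted product `s * m`. By coassociativity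
the Galois map of `s * m` then kills `∑ φ(c₁) ⊗ c₂`; that map is injective, and the counit recovers
`φ(c)`. -/
theorem eq_zero_of_convSMul_comp (s : (WithConv (C ⊗[k] C →ₗ[k] k))ˣ) (m : C ⊗[k] C →ₗ[k] C)
    (hm : Function.Injective (galois m)) (φ : C →ₗ[k] C)
    (h : convSMul s.val.ofConv m ∘ₗ φ.rTensor C ∘ₗ comul = 0) : φ = 0 := by
  have h1 : ∀ c, convSMul s.val.ofConv LinearMap.id (φ.rTensor C (comul c)) = 0 := by
    intro c
    apply hm
    have h2 := galois_rTensor_comul (convSMul s.val.ofConv m) φ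
    rw [h, galois_convSMul] at h2
    simpa using LinearMap.congr_fun h2 c
  -- The action of `s` on `C ⊗ C` is undone by that of its convolution inverse.
  have h2 : convSMul (s⁻¹).val.ofConv LinearMap.id ∘ₗ convSMul s.val.ofConv LinearMap.id =
      (LinearMap.id : C ⊗[k] C →ₗ[k] C ⊗[k] C) := by
    rw [comp_convSMul, LinearMap.comp_id, convSMul_convSMul]
    have h3 : convSMul s.val.ofConv (s⁻¹).val.ofConv = counit := by
      refine LinearMap.ext fun x => ?_
      have h4 := LinearMap.congr_fun congr(($(s.mul_inv)).ofConv) x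
      rw [(ℛ k x).convMul_apply] at h4
      rw [convSMul_repr (ℛ k x)]
      simpa using h4
    rw [h3]
    refine LinearMap.ext fun x => ?_
    rw [convSMul_repr (ℛ k x)]
    simpa using sum_counit_smul (ℛ k x)
  ext c
  have h3 : φ.rTensor C (comul (R := k) c) = 0 := by
    rw [← LinearMap.id_apply (R := k) (φ.rTensor C (comul (R := k) c)), ← h2,
      LinearMap.comp_apply, h1, map_zero]
  have h4 := congr(TensorProduct.rid k C ((counit (R := k)).lTensor C $h3))
  rw [← LinearMap.comp_apply (counit.lTensor C), lTensor_comp_rTensor, ← rTensor_comp_lTensor,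
    LinearMap.comp_apply, lTensor_counit_comul] at h4
  simpa using h4

end Galois

/-! ### The antipode and evaluation of forms at `∑ x₂ ⊗ S(x₁)` -/

section Antipode

variable {k : Type*} [Field k] {H : Type*} [Ring H] [HopfAlgebra k H]

open HopfAlgebra

/-- Both sides are convolution inverses of the coproduct in `Hom(H, H ⊗ H)`: the left one on the
right, the other on the left. For the latter, the coproduct is the convolution product of the two
inclusions `i₁`, `i₂` of `H`, each inverted by composing with `S`. -/
theorem comul_antipode (x : H) : comul (R := k) (antipode k x) =
    TensorProduct.map (antipode k) (antipode k) (TensorProduct.comm k H H (comul x)) := by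
  let i₁ : H →ₐ[k] H ⊗[k] H := Algebra.TensorProduct.includeLeft
  let i₂ : H →ₐ[k] H ⊗[k] H := Algebra.TensorProduct.includeRight
  let conv (i : H →ₐ[k] H ⊗[k] H) (f : H →ₗ[k] H) : WithConv (H →ₗ[k] H ⊗[k] H) :=
    toConv (i.toLinearMap ∘ₗ f)
  have hconv : ∀ i : H →ₐ[k] H ⊗[k] H, conv i (antipode k) * conv i LinearMap.id = 1 := by
    intro i
    have h := algHom_comp_convMul_distrib i (toConv (antipode k)) (toConv LinearMap.id)
    rw [antipode_mul_id] at h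
    refine WithConv.ext (h.symm.trans ?_)
    ext x
    simp
  have hG : conv i₂ (antipode k) * conv i₁ (antipode k) =
      toConv (TensorProduct.map (antipode k) (antipode k) ∘ₗ
        (TensorProduct.comm k H H).toLinearMap ∘ₗ comul) := by
    ext x
    rw [(ℛ k x).convMul_apply]
    simp only [LinearMap.comp_apply]
    rw [← (ℛ k x).eq]
    simp [conv, i₁, i₂]
  have hδ : conv i₁ LinearMap.id * conv i₂ LinearMap.id = toConv comul := by
    ext x
    rw [(ℛ k x).convMul_apply]
    dsimp only
    rw [← (ℛ k x).eq]
    simp [conv, i₁, i₂]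
  have h : conv i₂ (antipode k) * conv i₁ (antipode k) * toConv comul = 1 := by
    rw [← hδ, mul_assoc, ← mul_assoc (conv i₁ _), hconv, one_mul, hconv]
  have h2 := left_inv_eq_right_inv h (comul_right_inv (R := k) (C := H))
  rw [hG] at h2
  exact (LinearMap.congr_fun congr(($h2).ofConv) x).symm

theorem convSMul_comp_antipode {N : Type*} [AddCommGroup N] [Module k N] (f : H →ₗ[k] k)
    (g : H →ₗ[k] N) :
    convSMul f g ∘ₗ antipode k = smulConv (g ∘ₗ antipode k) (f ∘ₗ antipode k) := by
  ext x
  rw [smulConv_repr (ℛ k x)]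
  simp only [convSMul, LinearMap.comp_apply, comul_antipode]
  rw [← (ℛ k x).eq]
  simp

theorem smulConv_comp_antipode {N : Type*} [AddCommGroup N] [Module k N] (g : H →ₗ[k] N)
    (f : H →ₗ[k] k) :
    smulConv g f ∘ₗ antipode k = convSMul (f ∘ₗ antipode k) (g ∘ₗ antipode k) := by
  ext x
  rw [convSMul_repr (ℛ k x)]
  simp only [smulConv, LinearMap.comp_apply, comul_antipode]
  rw [← (ℛ k x).eq]
  simp

/-- A linear endomorphism of `H`, seen in the convolution algebra of maps `H → Hᵐᵒᵖ`. -/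
def opConv (f : H →ₗ[k] H) : WithConv (H →ₗ[k] Hᵐᵒᵖ) :=
  toConv ((MulOpposite.opLinearEquiv k).toLinearMap ∘ₗ f)

theorem opConv_apply (f : H →ₗ[k] H) (x : H) : opConv f x = MulOpposite.op (f x) := rfl

theorem opConv_convSMul (f : H →ₗ[k] k) (g : H →ₗ[k] H) :
    opConv (convSMul f g) = scalarConv Hᵐᵒᵖ (toConv f) * opConv g := by
  rw [opConv, comp_convSMul, toConv_convSMul]
  rfl

theorem opConv_smulConv (g : H →ₗ[k] H) (f : H →ₗ[k] k) :
    opConv (smulConv g f) = opConv g * scalarConv Hᵐᵒᵖ (toConv f) := by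
  rw [opConv, opConv, ← toConv_smulConv]
  congr 1
  ext x
  simp [smulConv_repr (ℛ k x)]

/-- In the opposite product this is `∑ S(x₂) S²(x₁) = S(∑ S(x₁) x₂) = ε(x)`. -/
theorem opConv_antipode_sq_mul_antipode :
    opConv (antipode k ∘ₗ antipode k) * opConv (antipode k) = (1 : WithConv (H →ₗ[k] Hᵐᵒᵖ)) := by
  ext x
  rw [(ℛ k x).convMul_apply]
  simp only [opConv_apply, LinearMap.comp_apply, ← MulOpposite.op_mul, ← antipode_mul_antidistrib]
  rw [← Finset.op_sum, ← map_sum, sum_antipode_mul_eq_algebraMap_counit]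
  simp [Algebra.algebraMap_eq_smul_one]

/-- `x ↦ ∑ x₂ ⊗ S(x₁)`. -/
def skewComul : H →ₗ[k] H ⊗[k] H :=
  (TensorProduct.comm k H H).toLinearMap ∘ₗ (antipode k).rTensor H ∘ₗ comul

theorem skewComul_repr {ι : Type*} {x : H} (R : Coalgebra.Repr k x ι) :
    skewComul (k := k) x = ∑ i ∈ R.index, R.right i ⊗ₜ antipode k (R.left i) := by
  simp [skewComul, ← R.eq]

/-- The form `x ⊗ y ↦ α(x) β(y)`. -/
def pureForm (α β : H →ₗ[k] k) : H ⊗[k] H →ₗ[k] k := mul' k k ∘ₗ TensorProduct.map α β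

theorem pureForm_tmul (α β : H →ₗ[k] k) (x y : H) : pureForm α β (x ⊗ₜ y) = α x * β y := by
  simp [pureForm]

theorem toConv_pureForm_comp_skewComul (α β : H →ₗ[k] k) :
    toConv (pureForm α β ∘ₗ skewComul) = toConv (β ∘ₗ antipode k) * toConv α := by
  ext x
  rw [(ℛ k x).convMul_apply]
  simp [skewComul_repr (ℛ k x), pureForm_tmul, mul_comm]

theorem convSMul_pureForm {N : Type*} [AddCommGroup N] [Module k N] (α β : H →ₗ[k] k)
    (g : H ⊗[k] H →ₗ[k] N) :
    convSMul (pureForm α β) g =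
      g ∘ₗ TensorProduct.map (convSMul α LinearMap.id) (convSMul β LinearMap.id) := by
  ext x y
  simp only [TensorProduct.AlgebraTensorModule.curry_apply, TensorProduct.curry_apply,
    LinearMap.coe_restrictScalars, LinearMap.comp_apply, TensorProduct.map_tmul]
  rw [convSMul_repr ((ℛ k x).tmul (ℛ k y)), convSMul_repr (ℛ k x), convSMul_repr (ℛ k y)]
  simp [Finset.sum_product, TensorProduct.sum_tmul, TensorProduct.tmul_sum, pureForm_tmul,
    mul_smul, ← TensorProduct.smul_tmul']
  rw [Finset.sum_comm]
  refine Finset.sum_congr rfl fun j _ => ?_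
  rw [Finset.smul_sum]
  exact Finset.sum_congr rfl fun i _ => smul_comm _ _ _

theorem smulConv_pureForm {N : Type*} [AddCommGroup N] [Module k N] (g : H ⊗[k] H →ₗ[k] N)
    (α β : H →ₗ[k] k) :
    smulConv g (pureForm α β) =
      g ∘ₗ TensorProduct.map (smulConv LinearMap.id α) (smulConv LinearMap.id β) := by
  ext x y
  simp only [TensorProduct.AlgebraTensorModule.curry_apply, TensorProduct.curry_apply,
    LinearMap.coe_restrictScalars, LinearMap.comp_apply, TensorProduct.map_tmul]
  rw [smulConv_repr ((ℛ k x).tmul (ℛ k y)), smulConv_repr (ℛ k x), smulConv_repr (ℛ k y)]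
  simp [Finset.sum_product, TensorProduct.sum_tmul, TensorProduct.tmul_sum, pureForm_tmul,
    mul_smul, ← TensorProduct.smul_tmul']
  rw [Finset.sum_comm]
  refine Finset.sum_congr rfl fun j _ => ?_
  rw [Finset.smul_sum]
  exact Finset.sum_congr rfl fun i _ => smul_comm _ _ _

/-- For a pure form the variables separate, so the value at `∑ x₂ ⊗ S(x₁)` is a convolution product
of `(β * id) ∘ S` and `α * id` with values in `Hᵐᵒᵖ`. As `S` reverses the coproduct, the first
factor is `S * (β ∘ S)`, and `(β ∘ S) * α` is the form evaluated at `∑ x₂ ⊗ S(x₁)`. -/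
theorem opConv_convSMul_pureForm_comp_skewComul (α β : H →ₗ[k] k) :
    opConv (convSMul (pureForm α β) (mul' k H) ∘ₗ skewComul) =
      opConv (antipode k) * scalarConv Hᵐᵒᵖ (toConv (pureForm α β ∘ₗ skewComul)) *
        opConv LinearMap.id := by
  have h : opConv (convSMul (pureForm α β) (mul' k H) ∘ₗ skewComul) =
      opConv (convSMul β LinearMap.id ∘ₗ antipode k) * opConv (convSMul α LinearMap.id) := by
    ext x
    rw [(ℛ k x).convMul_apply, convSMul_pureForm]
    simp [opConv_apply, skewComul_repr (ℛ k x)]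
  rw [h, convSMul_comp_antipode, opConv_smulConv, opConv_convSMul,
    toConv_pureForm_comp_skewComul, map_mul, LinearMap.id_comp]
  simp only [mul_assoc]

/-- The variables separate as before, now giving `(β ∘ S) * S * id * α` in `Hom(H, H)`, where `S *
id = 1` cancels in the middle. -/
theorem toConv_smulConv_pureForm_comp_skewComul (α β : H →ₗ[k] k) :
    toConv (smulConv (mul' k H ∘ₗ (TensorProduct.comm k H H).toLinearMap) (pureForm α β) ∘ₗ
      skewComul) = scalarConv H (toConv (pureForm α β ∘ₗ skewComul)) := by
  have h : toConv (smulConv (mul' k H ∘ₗ (TensorProduct.comm k H H).toLinearMap)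
      (pureForm α β) ∘ₗ skewComul) =
      toConv (smulConv LinearMap.id β ∘ₗ antipode k) * toConv (smulConv LinearMap.id α) := by
    ext x
    rw [(ℛ k x).convMul_apply, smulConv_pureForm]
    simp [skewComul_repr (ℛ k x)]
  rw [h, smulConv_comp_antipode, toConv_convSMul, toConv_smulConv, LinearMap.id_comp,
    toConv_pureForm_comp_skewComul, map_mul, mul_assoc, ← mul_assoc (toConv (antipode k)),
    antipode_mul_id, one_mul]

end Antipode

/-! ### The Drinfeld functional and the skew antipode -/

section Drinfeld

variable {k : Type*} [Field k] {H : Type*} [Ring H] [HopfAlgebra k H]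

open HopfAlgebra

theorem form_eq_sum_pureForm {ι : Type*} [Fintype ι] (e : Module.Basis ι k H)
    (f : H ⊗[k] H →ₗ[k] k) :
    f = ∑ i, pureForm ((TensorProduct.curry f).flip (e i)) (e.coord i) := by
  ext x y
  simp only [TensorProduct.AlgebraTensorModule.curry_apply, TensorProduct.curry_apply,
    LinearMap.coe_restrictScalars, LinearMap.sum_apply, pureForm_tmul, LinearMap.flip_apply]
  conv_lhs => rw [← e.sum_repr y, TensorProduct.tmul_sum, map_sum]
  simp [mul_comm]

/-- Expanding the second variable in a finite basis writes any form as a finite sum of pure ones;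
identities linear in the form need only be checked there. -/
theorem form_induction [FiniteDimensional k H] {P : (H ⊗[k] H →ₗ[k] k) → Prop}
    (h0 : P 0) (hadd : ∀ f g, P f → P g → P (f + g)) (hpure : ∀ α β, P (pureForm α β))
    (f : H ⊗[k] H →ₗ[k] k) : P f := by
  rw [form_eq_sum_pureForm (Module.finBasis k H) f]
  exact Finset.sum_induction _ P hadd h0 fun i _ => hpure _ _

theorem opConv_convSMul_comp_skewComul [FiniteDimensional k H] (f : H ⊗[k] H →ₗ[k] k) :
    opConv (convSMul f (mul' k H) ∘ₗ skewComul) =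
      opConv (antipode k) * scalarConv Hᵐᵒᵖ (toConv (f ∘ₗ skewComul)) * opConv LinearMap.id := by
  induction f using form_induction with
  | h0 => simp [convSMul, opConv]
  | hadd f g hf hg =>
    have h : opConv (convSMul (f + g) (mul' k H) ∘ₗ skewComul) =
        opConv (convSMul f (mul' k H) ∘ₗ skewComul) +
          opConv (convSMul g (mul' k H) ∘ₗ skewComul) := by
      ext x
      simp [opConv_apply, convSMul, TensorProduct.map_add_left]
    rw [h, hf, hg, LinearMap.add_comp, toConv_add, map_add, mul_add, add_mul]
  | hpure α β => exact opConv_convSMul_pureForm_comp_skewComul α β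

theorem toConv_smulConv_comp_skewComul [FiniteDimensional k H] (f : H ⊗[k] H →ₗ[k] k) :
    toConv (smulConv (mul' k H ∘ₗ (TensorProduct.comm k H H).toLinearMap) f ∘ₗ
      skewComul) = scalarConv H (toConv (f ∘ₗ skewComul)) := by
  induction f using form_induction with
  | h0 => simp [smulConv]
  | hadd f g hf hg =>
    rw [LinearMap.add_comp, toConv_add, map_add, ← hf, ← hg]
    ext x
    simp [smulConv, TensorProduct.map_add_right]
  | hpure α β => exact toConv_smulConv_pureForm_comp_skewComul α β

variable (r : UniversalRForm k H)

/-- The Drinfeld functional `x ↦ ∑ r(x₂ ⊗ S(x₁))`. -/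
def drinfeld : WithConv (H →ₗ[k] k) := toConv (r.form.val.ofConv ∘ₗ skewComul)

variable [FiniteDimensional k H]

/-- This is quasi-commutativity of `r` evaluated at `∑ x₂ ⊗ S(x₁)`: one side gives `∑ v(x₂) x₃
S(x₁)`, the other collapses to `v(x) 1`. -/
theorem antipode_mul_drinfeld_mul_id :
    opConv (antipode k) * scalarConv Hᵐᵒᵖ (drinfeld r) * opConv LinearMap.id =
      scalarConv Hᵐᵒᵖ (drinfeld r) := by
  rw [drinfeld, ← opConv_convSMul_comp_skewComul, r.quasi_comm]
  have h := toConv_smulConv_comp_skewComul r.form.val.ofConv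
  ext x
  have h2 := LinearMap.congr_fun congr(($h).ofConv) x
  exact congr(MulOpposite.op $h2)

theorem antipode_sq_mul_drinfeld :
    opConv (antipode k ∘ₗ antipode k) * scalarConv Hᵐᵒᵖ (drinfeld r) =
      scalarConv Hᵐᵒᵖ (drinfeld r) * opConv LinearMap.id := by
  conv_lhs => rw [← antipode_mul_drinfeld_mul_id r]
  rw [← mul_assoc, ← mul_assoc, opConv_antipode_sq_mul_antipode, one_mul]

/-- Dual form of Drinfeld's theorem that the square of the antipode is implemented by conjugation
with `v`. -/
theorem comp_antipode_sq_mul_drinfeld (α : H →ₗ[k] k) :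
    toConv (α ∘ₗ antipode k ∘ₗ antipode k) * drinfeld r = drinfeld r * toConv α := by
  ext x
  have h := congr(α (MulOpposite.unop
    $(LinearMap.congr_fun congr(($(antipode_sq_mul_drinfeld r)).ofConv) x)))
  rw [(ℛ k x).convMul_apply, (ℛ k x).convMul_apply] at h ⊢
  simpa [opConv_apply, scalarConv_apply, Algebra.algebraMap_eq_smul_one, mul_comm] using h

/-- The antipode axiom `∑ x₁ S(x₂) = ε(x) 1` with `x₁` and `S(x₂)` expanded in the basis, then
pushed through `ρ`. -/
theorem sum_coord_mul_coord_comp_antipode {ι : Type*} [Fintype ι] (e : Module.Basis ι k H)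
    (ρ : H →ₗ[k] WithConv (H →ₗ[k] k)) :
    ∑ i, ∑ j, toConv (e.coord i) * toConv (e.coord j ∘ₗ antipode k) * ρ (e i * e j) = ρ 1 := by
  have h : ∀ x : H, ∑ i, ∑ j, (toConv (e.coord i) * toConv (e.coord j ∘ₗ antipode k)) x •
      (e i * e j) = counit (R := k) x • (1 : H) := by
    intro x
    rw [← sum_mul_antipode_eq_smul (ℛ k x)]
    simp only [(ℛ k x).convMul_apply, Finset.sum_smul]
    rw [Finset.sum_congr rfl fun i _ => Finset.sum_comm, Finset.sum_comm]
    refine Finset.sum_congr rfl fun t _ => ?_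
    conv_rhs => rw [← e.sum_repr ((ℛ k x).left t), ← e.sum_repr (antipode k ((ℛ k x).right t))]
    rw [Finset.sum_mul_sum]
    simp [smul_smul, mul_comm]
  ext x
  have h2 : ∀ i j, (toConv (e.coord i) * toConv (e.coord j ∘ₗ antipode k) * ρ (e i * e j)) x =
      ∑ t ∈ (ℛ k x).index, ρ ((toConv (e.coord i) * toConv (e.coord j ∘ₗ antipode k))
        ((ℛ k x).left t) • (e i * e j)) ((ℛ k x).right t) := by
    intro i j
    rw [(ℛ k x).convMul_apply]
    simp only [map_smul, ofConv_smul, LinearMap.smul_apply, smul_eq_mul]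
  simp only [ofConv_sum, LinearMap.sum_apply, h2]
  rw [Finset.sum_congr rfl fun i _ => Finset.sum_comm, Finset.sum_comm]
  conv_rhs => rw [← sum_counit_smul (ℛ k x), map_sum]
  refine Finset.sum_congr rfl fun t _ => ?_
  have h3 := congr((ρ $(h ((ℛ k x).left t))).ofConv ((ℛ k x).right t))
  simp only [map_sum, ofConv_sum, LinearMap.sum_apply] at h3
  rw [h3]
  simp

theorem isUnit_drinfeld : IsUnit (drinfeld r) := by
  let e := Module.finBasis k H
  let ρ : H →ₗ[k] WithConv (H →ₗ[k] k) :=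
    (WithConv.linearEquiv k (H →ₗ[k] k)).symm.toLinearMap ∘ₗ
      (TensorProduct.curry r.form.val.ofConv).flip
  have hρ : ∀ a b, ρ (a * b) = ρ b * ρ a := by
    intro a b
    ext x
    exact r.mul_right x a b
  have hρ1 : ρ 1 = 1 := by
    ext x
    exact LinearMap.congr_fun r.one_right x
  have hv : drinfeld r = ∑ j, toConv (e.coord j ∘ₗ antipode k) * ρ (e j) := by
    rw [drinfeld]
    conv_lhs => rw [form_eq_sum_pureForm e r.form.val.ofConv]
    refine Eq.trans ?_ (Finset.sum_congr rfl fun j _ => toConv_pureForm_comp_skewComul _ _)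
    ext x
    simp
  -- The left inverse is `∑ eᵢ* * (ρ(eᵢ) ∘ S²)`. Moving `v` leftwards past `ρ(eᵢ) ∘ S²` removes the
  -- `S²`; expanding `v` and using that `ρ` reverses products leaves `∑ eᵢ* * (eⱼ* ∘ S) * ρ(eᵢ eⱼ) =
  -- ρ(1) = 1`.
  refine isUnit_of_mul_eq_one_left k (a := ∑ i, toConv (e.coord i) *
    toConv ((ρ (e i)).ofConv ∘ₗ antipode k ∘ₗ antipode k)) ?_
  rw [Finset.sum_mul, ← hρ1, ← sum_coord_mul_coord_comp_antipode e ρ]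
  refine Finset.sum_congr rfl fun i _ => ?_
  rw [mul_assoc, comp_antipode_sq_mul_drinfeld, hv, Finset.sum_mul, Finset.mul_sum]
  refine Finset.sum_congr rfl fun j _ => ?_
  rw [hρ, toConv_ofConv]
  simp only [mul_assoc]

/-- Solving `S * v * id = v` for the identity gives the left inverse `v⁻¹ * S * v`, which is
two-sided in finite dimension. -/
theorem isUnit_opConv_id (r : UniversalRForm k H) :
    IsUnit (opConv (LinearMap.id : H →ₗ[k] H)) := by
  obtain ⟨u, hu⟩ := (isUnit_drinfeld r).map (scalarConv Hᵐᵒᵖ)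
  have h := antipode_mul_drinfeld_mul_id r
  rw [← hu] at h
  refine isUnit_of_mul_eq_one_left k (a := (u⁻¹).val * (opConv (antipode k) * u.val)) ?_
  rw [mul_assoc, h, Units.inv_mul]

theorem isUnit_toConv_id : IsUnit (toConv (LinearMap.id : H →ₗ[k] H)) :=
  ⟨⟨_, _, id_mul_antipode, antipode_mul_id⟩, rfl⟩

theorem galois_mul_injective : Function.Injective (galois (mul' k H)) := by
  have h : galois (mul' k H) = translate (toConv (LinearMap.id : H →ₗ[k] H)) := by
    ext x y
    simp [galois_repr _ x (ℛ k y), translate_repr _ x (ℛ k y)]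
  rw [h]
  exact (translate_bijective isUnit_toConv_id).1

/-- Over `Hᵐᵒᵖ` the map `x ⊗ y ↦ ∑ y₁ x ⊗ y₂` is translation by the identity of `H`, a unit by
`isUnit_opConv_id`. -/
theorem galois_mul_comm_injective (r : UniversalRForm k H) : Function.Injective
    (galois (mul' k H ∘ₗ (TensorProduct.comm k H H).toLinearMap)) := by
  let o : H ⊗[k] H ≃ₗ[k] Hᵐᵒᵖ ⊗[k] H := (MulOpposite.opLinearEquiv k).rTensor H
  have h : o.toLinearMap ∘ₗ galois (mul' k H ∘ₗ (TensorProduct.comm k H H).toLinearMap) =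
      translate (opConv LinearMap.id) ∘ₗ o.toLinearMap := by
    ext x y
    simp [galois_repr _ x (ℛ k y), translate_repr _ _ (ℛ k y), o, opConv_apply]
  have h2 : Function.Injective (translate (opConv (LinearMap.id : H →ₗ[k] H)) ∘ₗ o.toLinearMap) :=
    (translate_bijective (isUnit_opConv_id r)).1.comp o.injective
  rw [← h, LinearMap.coe_comp] at h2
  exact h2.of_comp

end Drinfeld

/-! ### Flipping forms -/

section Flip

variable {k : Type*} [Field k] {C : Type*} [AddCommGroup C] [Module k C] [Coalgebra k C]

variable (k C) in
/-- The flip of `C ⊗ C`, as a morphism of coalgebras. -/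
def commCoalgHom : C ⊗[k] C →ₗc[k] C ⊗[k] C where
  toLinearMap := (TensorProduct.comm k C C).toLinearMap
  counit_comp := by
    ext x y
    simp [mul_comm]
  map_comp_comul := by
    ext x y
    simp only [TensorProduct.AlgebraTensorModule.curry_apply, TensorProduct.curry_apply,
      LinearMap.coe_restrictScalars, LinearMap.comp_apply, TensorProduct.comul_tmul,
      LinearEquiv.coe_coe, TensorProduct.comm_tmul]
    rw [← (ℛ k x).eq, ← (ℛ k y).eq]
    simp only [TensorProduct.sum_tmul, TensorProduct.tmul_sum, map_sum]
    rw [Finset.sum_comm]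
    simp

theorem flip_mul_flip {s t : WithConv (C ⊗[k] C →ₗ[k] k)} (h : s * t = 1) :
    toConv (s.ofConv ∘ₗ (TensorProduct.comm k C C).toLinearMap) *
      toConv (t.ofConv ∘ₗ (TensorProduct.comm k C C).toLinearMap) = 1 := by
  have h2 := convMul_comp_coalgHom_distrib s t (commCoalgHom k C)
  rw [h] at h2
  refine WithConv.ext (h2.symm.trans ?_)
  ext x y
  simp [commCoalgHom, mul_comm]

/-- The form `x ⊗ y ↦ s(y ⊗ x)`, together with its convolution inverse. -/
def flipForm (s : (WithConv (C ⊗[k] C →ₗ[k] k))ˣ) : (WithConv (C ⊗[k] C →ₗ[k] k))ˣ where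
  val := toConv (s.val.ofConv ∘ₗ (TensorProduct.comm k C C).toLinearMap)
  inv := toConv ((s⁻¹).val.ofConv ∘ₗ (TensorProduct.comm k C C).toLinearMap)
  val_inv := flip_mul_flip s.mul_inv
  inv_val := flip_mul_flip s.inv_mul

end Flip

/-! ### The form `r_σ` and convolution invertibility of `H → A_σ` -/

section CleavingMap

variable {k : Type*} [Field k] {H : Type*} [Ring H] [HopfAlgebra k H] (σ : LeftTwoCocycle k H)

theorem crossedMul_comp_comm : crossedMul σ ∘ₗ (TensorProduct.comm k H H).toLinearMap =
    convSMul (flipForm σ.form).val.ofConv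
      (mul' k H ∘ₗ (TensorProduct.comm k H H).toLinearMap) :=
  convSMul_comp σ.form.val.ofConv (mul' k H) (commCoalgHom k H)

/-- With `μ` the multiplication, the left side is `στ * μᵒᵖ * r = στ * r * μ` by
quasi-commutativity; inserting `σ⁻¹ * σ` before `μ` produces `r_σ` and the crossed product. -/
theorem smulConv_crossedMul_comm (r : UniversalRForm k H) :
    smulConv (crossedMul σ ∘ₗ (TensorProduct.comm k H H).toLinearMap) r.form.val.ofConv =
      convSMul (twistedRForm σ r).ofConv (crossedMul σ) := by
  apply toConv_injective
  have hr : scalarConv H r.form.val * toConv (mul' k H) =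
      toConv (mul' k H ∘ₗ (TensorProduct.comm k H H).toLinearMap) *
        scalarConv H r.form.val := by
    have h := congr(toConv $(r.quasi_comm))
    rwa [toConv_convSMul, toConv_smulConv] at h
  rw [toConv_smulConv, crossedMul_comp_comm, toConv_convSMul, toConv_convSMul, crossedMul,
    toConv_convSMul, toConv_ofConv, toConv_ofConv, toConv_ofConv, toConv_ofConv, mul_assoc, ← hr,
    twistedRForm, ← mul_assoc, ← mul_assoc, ← map_mul, ← map_mul, mul_assoc _ _ σ.form.val,
    Units.inv_mul, mul_one]
  rfl

theorem mul_braiding (r : UniversalRForm k H) (b c : H) :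
    mul' k (Cleft σ) (braiding r (Cleft σ) (Cleft σ) (Cleft.of σ b ⊗ₜ Cleft.of σ c)) =
      Cleft.of σ (convSMul (twistedRForm σ r).ofConv (crossedMul σ) (c ⊗ₜ b)) := by
  rw [← smulConv_crossedMul_comm, smulConv_repr ((ℛ k c).tmul (ℛ k b))]
  simp only [braiding, LinearMap.comp_apply, LinearEquiv.coe_coe, TensorProduct.comm_tmul,
    TensorProduct.map_tmul, Cleft.coact_def, LinearEquiv.symm_apply_apply]
  rw [← (ℛ k c).eq, ← (ℛ k b).eq]
  simp only [map_sum, TensorProduct.sum_tmul, TensorProduct.tmul_sum]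
  simp [Finset.sum_product, Cleft.mul_def]
  rw [Finset.sum_comm]

/-- The map `H → A_σ`. -/
def cleaving : WithConv (H →ₗ[k] Cleft σ) := toConv (Cleft.of σ).toLinearMap

/-- The map `H → A_σᵐᵒᵖ`. -/
def opCleaving : WithConv (H →ₗ[k] (Cleft σ)ᵐᵒᵖ) :=
  toConv ((MulOpposite.opLinearEquiv k).toLinearMap ∘ₗ (Cleft.of σ).toLinearMap)

variable [FiniteDimensional k H]

/-- The product of `A_σ` is the opposite multiplication of `H` twisted by the flipped cocycle, so
cancellation rests on the Galois map of the opposite multiplication, hence on `r`. -/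
theorem isUnit_cleaving (r : UniversalRForm k H) : IsUnit (cleaving σ) := by
  refine isUnit_of_forall_mul_eq_zero k fun φ hφ => ?_
  have h := eq_zero_of_convSMul_comp (flipForm σ.form) _ (galois_mul_comm_injective r)
    ((Cleft.of σ).symm.toLinearMap ∘ₗ φ.ofConv) ?_
  · ext x
    exact LinearMap.congr_fun h x
  · rw [← crossedMul_comp_comm]
    ext x
    have h2 := congr((Cleft.of σ).symm $(LinearMap.congr_fun congr(($hφ).ofConv) x))
    rw [(ℛ k x).convMul_apply] at h2
    simp only [LinearMap.comp_apply]
    rw [← (ℛ k x).eq]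
    simpa [cleaving, Cleft.mul_def] using h2

/-- The product of `A_σᵒᵖ` is the multiplication of `H` twisted by `σ`, so here the ordinary
antipode suffices. -/
theorem isUnit_opCleaving : IsUnit (opCleaving σ) := by
  refine isUnit_of_forall_mul_eq_zero k fun φ hφ => ?_
  have h := eq_zero_of_convSMul_comp σ.form _ galois_mul_injective
    ((Cleft.of σ).symm.toLinearMap ∘ₗ (MulOpposite.opLinearEquiv k).symm.toLinearMap ∘ₗ
      φ.ofConv) ?_
  · ext x
    exact congr(MulOpposite.op $(LinearMap.congr_fun h x))
  · ext x
    have h2 := congr((Cleft.of σ).symm (MulOpposite.unop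
      $(LinearMap.congr_fun congr(($hφ).ofConv) x)))
    rw [(ℛ k x).convMul_apply] at h2
    simp only [LinearMap.comp_apply]
    rw [← (ℛ k x).eq]
    simpa [opCleaving, Cleft.mul_def, crossedMul] using h2

end CleavingMap

/-! ### Factorization of the Azumaya maps -/

section Comparison

variable {k : Type*} [Field k] {C A : Type*} [AddCommGroup C] [Module k C] [Coalgebra k C]
  [Ring A] [Algebra k A]

/-- `a ⊗ b ↦ (c ↦ ∑ θ(b₁)(c₁) a γ(b₂) γ(c₂))`. -/
def comparison (θ : C →ₗ[k] Module.Dual k C) (γ : C →ₗ[k] A) : A ⊗[k] C →ₗ[k] (C →ₗ[k] A) :=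
  (WithConv.linearEquiv k (C →ₗ[k] A)).toLinearMap ∘ₗ LinearMap.mulRight k (toConv γ) ∘ₗ
    (WithConv.linearEquiv k (C →ₗ[k] A)).symm.toLinearMap ∘ₗ dualTensorHom k C A ∘ₗ
    (TensorProduct.comm k A (Module.Dual k C)).toLinearMap ∘ₗ θ.lTensor A ∘ₗ
    cotranslate (toConv ((MulOpposite.opLinearEquiv k).toLinearMap ∘ₗ γ))

theorem comparison_apply (θ : C →ₗ[k] Module.Dual k C) (γ : C →ₗ[k] A) (a : A) (b c : C) :
    comparison θ γ (a ⊗ₜ b) c = a * convSMul (TensorProduct.lift θ)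
      (mul' k A ∘ₗ TensorProduct.map γ γ) (b ⊗ₜ c) := by
  rw [convSMul_tmul _ _ (ℛ k b)]
  simp only [comparison, LinearMap.comp_apply, cotranslate_repr _ a (ℛ k b), map_sum,
    convSMul_repr (ℛ k c), LinearMap.sum_apply, Finset.mul_sum]
  refine Finset.sum_congr rfl fun i _ => ?_
  simp only [lTensor_tmul, LinearEquiv.coe_coe, TensorProduct.comm_tmul,
    WithConv.linearEquiv_apply, WithConv.symm_linearEquiv_apply, mulRight_apply,
    (ℛ k c).convMul_apply]
  simp [mul_assoc]

theorem comparison_bijective_iff [FiniteDimensional k C] [FiniteDimensional k A] [Nontrivial A]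
    (θ : C →ₗ[k] Module.Dual k C) (γ : C →ₗ[k] A) (h : IsUnit (toConv γ))
    (hop : IsUnit (toConv ((MulOpposite.opLinearEquiv k (M := A)).toLinearMap ∘ₗ γ))) :
    Function.Bijective (comparison θ γ) ↔ Function.Bijective θ := by
  have h1 : Function.Bijective (LinearMap.mulRight k (toConv γ)) := by
    obtain ⟨u, hu⟩ := h
    rw [← hu]
    exact (Units.mulRight u).bijective
  have h2 := cotranslate_bijective hop
  have h3 : Function.Bijective (dualTensorHom k C A) := (dualTensorHomEquiv k C A).bijective
  rw [comparison]
  simp only [LinearMap.coe_comp, LinearEquiv.coe_coe]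
  -- Stripping the bijective factors on both sides leaves `θ` tensored with `A`; a nonzero vector
  -- space is faithfully flat.
  rw [(LinearEquiv.bijective _).of_comp_iff', h1.of_comp_iff', (LinearEquiv.bijective _).of_comp_iff',
    h3.of_comp_iff', (LinearEquiv.bijective _).of_comp_iff', Function.Bijective.of_comp_iff _ h2,
    Module.FaithfullyFlat.lTensor_bijective_iff_bijective]

end Comparison

/-! ### Identification of `F` and `G`, and conclusion -/

section Main

variable {k : Type*} [Field k] {H : Type*} [Ring H] [HopfAlgebra k H]

theorem nontrivial_of_hopfAlgebra (k H : Type*) [Field k] [Ring H] [HopfAlgebra k H] :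
    Nontrivial H := by
  refine ⟨0, 1, fun h => zero_ne_one (α := k) ?_⟩
  rw [← Bialgebra.counit_one (R := k) (A := H), ← h, map_zero]

theorem azumayaFLin_cleft (r : UniversalRForm k H) (σ : LeftTwoCocycle k H) (a : Cleft σ)
    (b c : H) :
    azumayaFLin r (Cleft σ) (a ⊗ₜ BraidedOpp.of r (Cleft σ) (Cleft.of σ b)) (Cleft.of σ c) =
      comparison (theta σ r) (Cleft.of σ).toLinearMap (a ⊗ₜ b) c := by
  have h := convSMul_comp (twistedRForm σ r).ofConv ((Cleft.of σ).toLinearMap ∘ₗ crossedMul σ)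
    (commCoalgHom k H)
  rw [← comp_convSMul] at h
  have h1 : TensorProduct.lift (theta σ r) =
      (twistedRForm σ r).ofConv ∘ₗ (commCoalgHom k H).toLinearMap := by
    ext x y
    rfl
  have h2 : mul' k (Cleft σ) ∘ₗ
      TensorProduct.map (Cleft.of σ).toLinearMap (Cleft.of σ).toLinearMap =
      ((Cleft.of σ).toLinearMap ∘ₗ crossedMul σ) ∘ₗ (commCoalgHom k H).toLinearMap := by
    ext x y
    rfl
  rw [azumayaFLin_apply, LinearEquiv.symm_apply_apply, mul_braiding, comparison_apply, h1, h2, ← h]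
  rfl

/-- In `A_σ` the value is `∑ r_σ(a₁ ⊗ c₁) c₂ a₂ b`. Read in `A_σᵒᵖ` the factors become `b a₂ c₂`,
the shape required by `comparison`, with `r_σ(a ⊗ -)` in place of `θ_σ`. -/
theorem azumayaGLin_cleft (r : UniversalRForm k H) (σ : LeftTwoCocycle k H) (a : H)
    (b : Cleft σ) (c : H) :
    MulOpposite.op (azumayaGLin r (Cleft σ) (BraidedOpp.of r (Cleft σ) (Cleft.of σ a) ⊗ₜ b)
      (Cleft.of σ c)) =
      comparison (TensorProduct.curry (twistedRForm σ r).ofConv) (opCleaving σ).ofConv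
        (MulOpposite.op b ⊗ₜ a) c := by
  have h1 : TensorProduct.lift (TensorProduct.curry (twistedRForm σ r).ofConv) =
      (twistedRForm σ r).ofConv := by
    ext x y
    rfl
  have h2 : mul' k (Cleft σ)ᵐᵒᵖ ∘ₗ
      TensorProduct.map (opCleaving σ).ofConv (opCleaving σ).ofConv =
      ((MulOpposite.opLinearEquiv k).toLinearMap ∘ₗ (Cleft.of σ).toLinearMap) ∘ₗ
        crossedMul σ := by
    ext x y
    rfl
  rw [azumayaGLin_apply, LinearEquiv.symm_apply_apply, mul_braiding, comparison_apply, h1, h2,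
    ← comp_convSMul]
  rfl

variable [FiniteDimensional k H]

theorem azumayaF_bijective_iff (r : UniversalRForm k H) (σ : LeftTwoCocycle k H) :
    Function.Bijective (azumayaF r (Cleft σ)) ↔ Function.Bijective (theta σ r) := by
  have : Nontrivial (Cleft σ) := nontrivial_of_hopfAlgebra k H
  rw [← comparison_bijective_iff (theta σ r) (Cleft.of σ).toLinearMap (isUnit_cleaving σ r)
    (isUnit_opCleaving σ)]
  let e₁ : Cleft σ ⊗[k] H ≃ₗ[k] Smash r (Cleft σ) (BraidedOpp r (Cleft σ)) :=
    (Cleft.of σ ≪≫ₗ BraidedOpp.of r (Cleft σ)).lTensor (Cleft σ) ≪≫ₗ Smash.of r _ _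
  let e₂ : Module.End k (Cleft σ) ≃ₗ[k] (H →ₗ[k] Cleft σ) :=
    (Cleft.of σ).symm.arrowCongr (LinearEquiv.refl k (Cleft σ))
  have h : comparison (theta σ r) (Cleft.of σ).toLinearMap =
      e₂.toLinearMap ∘ₗ (azumayaF r (Cleft σ)).toLinearMap ∘ₗ e₁.toLinearMap := by
    ext a b c
    exact (azumayaFLin_cleft r σ a b c).symm
  rw [h]
  simp only [LinearMap.coe_comp, LinearEquiv.coe_coe, AlgHom.coe_toLinearMap]
  rw [e₂.bijective.of_comp_iff', Function.Bijective.of_comp_iff _ e₁.bijective]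

theorem azumayaG_bijective_iff (r : UniversalRForm k H) (σ : LeftTwoCocycle k H) :
    Function.Bijective (azumayaG r (Cleft σ)) ↔
      Function.Bijective (TensorProduct.curry (twistedRForm σ r).ofConv) := by
  have : Nontrivial (Cleft σ) := nontrivial_of_hopfAlgebra k H
  have hop : IsUnit (toConv ((MulOpposite.opLinearEquiv k (M := (Cleft σ)ᵐᵒᵖ)).toLinearMap ∘ₗ
      (opCleaving σ).ofConv)) := by
    -- With `A_σᵒᵖ` as base algebra the second invertibility condition lives over the double
    -- opposite, so the unit `cleaving σ` is transported along `A_σ ≅ A_σᵒᵖᵒᵖ`.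
    let f : WithConv (H →ₗ[k] Cleft σ) →* WithConv (H →ₗ[k] (Cleft σ)ᵐᵒᵖᵐᵒᵖ) :=
      { toFun := fun φ => toConv ((AlgEquiv.opOp k (Cleft σ)).toLinearMap ∘ₗ φ.ofConv)
        map_one' := by
          ext x
          rfl
        map_mul' := fun φ ψ => WithConv.ext
          (algHom_comp_convMul_distrib (AlgEquiv.opOp k (Cleft σ)).toAlgHom φ ψ) }
    exact (isUnit_cleaving σ r).map f
  rw [← comparison_bijective_iff _ (opCleaving σ).ofConv (isUnit_opCleaving σ) hop]
  let e₁ : (Cleft σ)ᵐᵒᵖ ⊗[k] H ≃ₗ[k] Smash r (BraidedOpp r (Cleft σ)) (Cleft σ) :=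
    TensorProduct.congr (MulOpposite.opLinearEquiv k).symm
      (Cleft.of σ ≪≫ₗ BraidedOpp.of r (Cleft σ)) ≪≫ₗ TensorProduct.comm k _ _ ≪≫ₗ Smash.of r _ _
  let e₂ : (Module.End k (Cleft σ))ᵐᵒᵖ ≃ₗ[k] (H →ₗ[k] (Cleft σ)ᵐᵒᵖ) :=
    (MulOpposite.opLinearEquiv k).symm ≪≫ₗ
      (Cleft.of σ).symm.arrowCongr (MulOpposite.opLinearEquiv k)
  have h : comparison (TensorProduct.curry (twistedRForm σ r).ofConv) (opCleaving σ).ofConv =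
      e₂.toLinearMap ∘ₗ (azumayaG r (Cleft σ)).toLinearMap ∘ₗ e₁.toLinearMap := by
    ext b a c
    exact (azumayaGLin_cleft r σ a b.unop c).symm
  rw [h]
  simp only [LinearMap.coe_comp, LinearEquiv.coe_coe, AlgHom.coe_toLinearMap]
  rw [e₂.bijective.of_comp_iff', Function.Bijective.of_comp_iff _ e₁.bijective]

theorem bijective_of_bijective_flip {V : Type*} [AddCommGroup V] [Module k V]
    [FiniteDimensional k V] (B : V →ₗ[k] Module.Dual k V) (h : Function.Bijective B.flip) :
    Function.Bijective B := by
  have hinj : Function.Injective B := by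
    refine (injective_iff_map_eq_zero _).2 fun x hx => ?_
    -- Surjectivity of the transpose makes every functional of the form `B(-)(y)`, so all
    -- functionals vanish on the kernel of `B`.
    refine (Module.forall_dual_apply_eq_zero_iff k x).1 fun f => ?_
    obtain ⟨y, rfl⟩ := h.2 f
    rw [LinearMap.flip_apply, hx, LinearMap.zero_apply]
  exact ⟨hinj, (LinearMap.injective_iff_surjective_of_finrank_eq_finrank
    Subspace.dual_finrank_eq.symm).1 hinj⟩

end Main

end CleftAzumaya

end

theorem theorem2p1 (k : Type*) [Field k] (H : Type*) [Ring H] [HopfAlgebra k H]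
    [FiniteDimensional k H] (r : CleftAzumaya.UniversalRForm k H)
    (σ : CleftAzumaya.LeftTwoCocycle k H) :
    CleftAzumaya.IsAzumaya r (CleftAzumaya.Cleft σ) ↔
      Function.Bijective (CleftAzumaya.theta σ r) := by
  rw [CleftAzumaya.IsAzumaya, CleftAzumaya.azumayaF_bijective_iff,
    CleftAzumaya.azumayaG_bijective_iff, and_iff_left_iff_imp]
  exact CleftAzumaya.bijective_of_bijective_flip _
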